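/- **Setting.** A function $f:\{0,1\}^n\to\{0,1\}$ is symmetric if $f(a)$ depends only on the Hamming weight $|a|$; write $f(a)=\mathrm{Spec}f(|a|)$ with $\mathrm{Spec}f:\{0,\dots,n\}\to\{0,1\}$. The period $\mathrm{per}(f)$ is the least integer $b\ge 1$ with $\mathrm{Spec}f(i)=\mathrm{Spec}f(i+b)$ for all integers $0\le i\le n-b$, and $B(f)$ is the least integer $k\ge 0$ such that $\mathrm{Spec}f$ is constant on the integers in $[k,n-k]$. A standard decomposition of a symmetric $f$ is a pair $(g,h)$ where $g$ has the smallest possible period among all symmetric functions whose spectrum agrees with $\mathrm{Spec}f$ on the integers in $[\lceil n/3\rceil,\lfloor 2n/3\rfloor]$, and $h=f\oplus g$. For a field $\mathbb F$ and $\varepsilon>0$, the $\varepsilon$-error probabilistic degree $\mathrm{pdeg}^{\mathbb F}_\varepsilon(f)$ is the least $d$ such that there is a finitely supported probability distribution on polynomials $\mathbf P\in\mathbb F[x_1,\dots,x_n]$ of degree at most $d$ with $\Pr[\mathbf P(a)\ne f(a)]\le\varepsilon$ for every $a\in\{0,1\}^n$. "A power of $p$" means $p^t$ with $t\ge 1$,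 and $L_\varepsilon:=\max\{\log(1/\varepsilon),0\}$ (which is $\log(1/\varepsilon)$ for $\varepsilon\le 1$). **Theorem 1.2.** Let $p$ be $0$ or a prime. There are constants $C>0$ and $k\in\mathbb N$ depending only on $p$ such that, with $\lambda_n:=(1+\log n)^k$ if $p=0$ (and $\lambda_0:=1$) and $\lambda_n:=1$ if $p>0$, the following holds for every field $\mathbb F$ of characteristic $p$, every $n\in\mathbb N$, every symmetric $f:\{0,1\}^n\to\{0,1\}$, every standard decomposition $(g,h)$ of $f$ and every $\varepsilon>0$. 1. If $\mathrm{per}(g)=1$, then $\mathrm{pdeg}^{\mathbb F}_\varepsilon(g)=0$. If $\mathrm{per}(g)$ is a power of $p$, then $\mathrm{pdeg}^{\mathbb F}_\varepsilon(g)\le\mathrm{per}(g)$. 2. If $B(h)\ge 1$, then $\mathrm{pdeg}^{\mathbb F}_\varepsilon(h)\le C\lambda_n\bigl(\sqrt{B(h)L_\varepsilon}+L_\varepsilon\bigr)$. If $B(h)=0$, then $\mathrm{pdeg}^{\mathbb F}_\varepsilon(h)=0$. 3. - If $\mathrm{per}(g)>1$ and $\mathrm{per}(g)$ is not a power of $p$,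 then $\mathrm{pdeg}^{\mathbb F}_\varepsilon(f)\le C\sqrt{nL_\varepsilon}$. - If $\mathrm{per}(g)$ is a power of $p$ and $B(h)=0$, then $\mathrm{pdeg}^{\mathbb F}_\varepsilon(f)\le C\min\{\sqrt{nL_\varepsilon},\,\mathrm{per}(g)\}$. - In all other cases, $\mathrm{pdeg}^{\mathbb F}_\varepsilon(f)\le C\lambda_n\min\{\sqrt{nL_\varepsilon},\ \mathrm{per}(g)+\sqrt{B(h)L_\varepsilon}+L_\varepsilon\}$. -/

import Mathlib

namespace SymPdeg

/-- The Hamming weight of a Boolean vector. -/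
def weight {n : ℕ} (a : Fin n → Bool) : ℕ := (Finset.univ.filter fun i => a i = true).card

/-- A Boolean function is symmetric if its value depends only on the Hamming weight. -/
def IsSymmetric {n : ℕ} (f : (Fin n → Bool) → Bool) : Prop :=
  ∀ a b : Fin n → Bool, weight a = weight b → f a = f b

/-- The Boolean vector `1^k 0^(n-k)`; it has weight `k` when `k ≤ n`. -/
def prefixVec (n k : ℕ) : Fin n → Bool := fun i => decide (i.val < k)

/-- The spectrum of a (symmetric) Boolean function on `n` variables: its value at weight `k`.
Only the arguments `k ≤ n` are meaningful, and only those are used below. -/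
def spec {n : ℕ} (f : (Fin n → Bool) → Bool) (k : ℕ) : Bool := f (prefixVec n k)

theorem weight_prefixVec {n k : ℕ} (hk : k ≤ n) : weight (prefixVec n k) = k := by
  have h : (Finset.univ.filter fun i : Fin n => prefixVec n k i = true)
      = Finset.univ.filter fun i : Fin n => i.val < k := by
    ext i; simp [prefixVec]
  rw [weight, h, Fin.card_filter_val_lt]
  exact min_eq_right hk

theorem weight_le {n : ℕ} (a : Fin n → Bool) : weight a ≤ n := by
  simpa [weight] using Finset.card_le_univ (Finset.univ.filter fun i => a i = true)

/-- The defining property of the spectrum: `f a = Spec f (|a|)`. -/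
theorem IsSymmetric.eq_spec {n : ℕ} {f : (Fin n → Bool) → Bool} (hf : IsSymmetric f)
    (a : Fin n → Bool) : f a = spec f (weight a) :=
  hf _ _ (weight_prefixVec (weight_le a)).symm

/-- `b` is a positive integer with `Spec f i = Spec f (i + b)` for all `i ∈ [0, n - b]`. -/
def IsPeriod {n : ℕ} (f : (Fin n → Bool) → Bool) (b : ℕ) : Prop :=
  0 < b ∧ ∀ i : ℕ, i + b ≤ n → spec f i = spec f (i + b)

theorem exists_isPeriod {n : ℕ} (f : (Fin n → Bool) → Bool) : ∃ b, IsPeriod f b :=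
  ⟨n + 1, Nat.succ_pos n, fun i hi => by omega⟩

/-- The period `per(f)`: the smallest period of `f`. -/
noncomputable def per {n : ℕ} (f : (Fin n → Bool) → Bool) : ℕ := sInf {b | IsPeriod f b}

theorem isPeriod_per {n : ℕ} (f : (Fin n → Bool) → Bool) : IsPeriod f (per f) :=
  Nat.sInf_mem (exists_isPeriod f)

/-- `f` is `k`-bounded: `Spec f` is constant on the integer interval `[k, n - k]`. -/
def IsBounded {n : ℕ} (f : (Fin n → Bool) → Bool) (k : ℕ) : Prop :=
  ∀ i j : ℕ, k ≤ i → i + k ≤ n → k ≤ j → j + k ≤ n → spec f i = spec f j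

theorem exists_isBounded {n : ℕ} (f : (Fin n → Bool) → Bool) : ∃ k, IsBounded f k :=
  ⟨n + 1, fun i j _ hi _ _ => by omega⟩

/-- `B(f)`: the smallest `k` such that `f` is `k`-bounded. -/
noncomputable def bdd {n : ℕ} (f : (Fin n → Bool) → Bool) : ℕ := sInf {k | IsBounded f k}

theorem isBounded_bdd {n : ℕ} (f : (Fin n → Bool) → Bool) : IsBounded f (bdd f) :=
  Nat.sInf_mem (exists_isBounded f)

/-- `f` and `g` have the same spectrum on `[⌈n/3⌉, ⌊2n/3⌋]`. For an integer `i`, membership in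
this interval means `n ≤ 3 i` and `3 i ≤ 2 n`. -/
def AgreeInMiddle {n : ℕ} (f g : (Fin n → Bool) → Bool) : Prop :=
  ∀ i : ℕ, n ≤ 3 * i → 3 * i ≤ 2 * n → spec g i = spec f i

/-- `(g, h)` is a standard decomposition of `f`: among the symmetric functions that agree with `f`
in the middle, `g` is one of least period, and `h = f ⊕ g`. -/
structure IsStandardDecomposition {n : ℕ} (f g h : (Fin n → Bool) → Bool) : Prop where
  symmetric : IsSymmetric g
  agree : AgreeInMiddle f g
  minimal : ∀ g' : (Fin n → Bool) → Bool, IsSymmetric g' → AgreeInMiddle f g' → per g ≤ per g'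
  bounded_part : ∀ a, h a = xor (f a) (g a)

/-- A Boolean value as an element of the field: `false ↦ 0`, `true ↦ 1`. -/
def toField (F : Type*) [Field F] (b : Bool) : F := if b then 1 else 0

/-- The distribution `P` on polynomials is an `ε`-error probabilistic polynomial for `f` of
degree at most `d`: it has finite support, consisting of polynomials of degree at most `d`, and
for every input `a` the probability that the random polynomial differs from `f` at `a` is at
most `ε`. -/
structure IsProbPoly {F : Type*} [Field F] {n : ℕ} (ε : ℝ) (f : (Fin n → Bool) → Bool) (d : ℕ)
    (P : PMF (MvPolynomial (Fin n) F)) : Prop where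
  finite_support : P.support.Finite
  degree_le : ∀ Q ∈ P.support, Q.totalDegree ≤ d
  error_le : ∀ a : Fin n → Bool,
    P.toOuterMeasure {Q | MvPolynomial.eval (fun i => toField F (a i)) Q ≠ toField F (f a)}
      ≤ ENNReal.ofReal ε

/-- The `ε`-error probabilistic degree of `f` over `F`: the least `d` such that `f` has an
`ε`-error probabilistic polynomial of degree at most `d`. -/
noncomputable def pdeg (F : Type*) [Field F] {n : ℕ} (ε : ℝ) (f : (Fin n → Bool) → Bool) : ℕ :=
  sInf {d | ∃ P : PMF (MvPolynomial (Fin n) F), IsProbPoly ε f d P}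

theorem exists_isProbPoly (F : Type*) [Field F] {n : ℕ} (ε : ℝ) (f : (Fin n → Bool) → Bool) :
    ∃ d, ∃ P : PMF (MvPolynomial (Fin n) F), IsProbPoly ε f d P := by
  classical
  let Q : MvPolynomial (Fin n) F := ∑ b : Fin n → Bool, MvPolynomial.C (toField F (f b)) *
    ∏ i, (if b i then MvPolynomial.X i else 1 - MvPolynomial.X i)
  have hQ : ∀ a : Fin n → Bool,
      MvPolynomial.eval (fun i => toField F (a i)) Q = toField F (f a) := by
    intro a
    simp only [Q, map_sum, map_mul, map_prod, MvPolynomial.eval_C]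
    rw [Finset.sum_eq_single a]
    · rw [Finset.prod_eq_one, mul_one]
      intro i _
      cases h : a i <;> simp [h, toField]
    · intro b _ hb
      obtain ⟨i, hi⟩ := Function.ne_iff.mp hb
      rw [Finset.prod_eq_zero (Finset.mem_univ i), mul_zero]
      cases h : a i <;> cases h' : b i <;> simp_all [toField]
    · simp
  refine ⟨Q.totalDegree, PMF.pure Q, ?_, ?_, ?_⟩
  · simp [PMF.support_pure]
  · intro R hR
    simp only [PMF.support_pure, Set.mem_singleton_iff] at hR
    rw [hR]
  · intro a
    rw [PMF.toOuterMeasure_pure_apply]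
    simp [hQ a]

/-- The probabilistic degree is attained. -/
theorem pdeg_spec (F : Type*) [Field F] {n : ℕ} (ε : ℝ) (f : (Fin n → Bool) → Bool) :
    ∃ P : PMF (MvPolynomial (Fin n) F), IsProbPoly ε f (pdeg F ε f) P :=
  Nat.sInf_mem (exists_isProbPoly F ε f)

/-- `b` is a power of `p` with exponent at least `1`. -/
def IsPowerOf (p b : ℕ) : Prop := ∃ t : ℕ, 1 ≤ t ∧ b = p ^ t

/-- `log (1/ε)` for `0 < ε ≤ 1`, and `0` for `ε ≥ 1`. -/
noncomputable def logInv (ε : ℝ) : ℝ := max (Real.log (1 / ε)) 0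

/-- The factor hidden in the soft-O notation: `(1 + log n) ^ k` in characteristic `0`, and no
extra factor at all in positive characteristic. -/
noncomputable def softFactor (p k n : ℕ) : ℝ := if p = 0 then (1 + Real.log n) ^ k else 1

end SymPdeg

open SymPdeg

/-!
Everything is a statement about functions on the Boolean cube that are restrictions of polynomials
of low degree (`LowDeg`), chosen at random from a finite uniform sample space. Integer-valued
interpolation by the elementary symmetric polynomials shows that any function of the weight `|x|`
can be interpolated exactly on an interval of `D + 1` weights in degree `D`, in any characteristic
(`exists_lowDeg_interpolation`). In characteristic `p` the binomials `binom(·, k)`, `k < p ^ t`,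
have period `p ^ t`, so a function of the weight of period `p ^ t` has exact degree below `p ^ t`
(`lowDeg_of_periodic`); this is the periodic part `g`.

For inputs with `|x| < M`, random functions of degree `O(√(Mℓ) + ℓ)` compute all the indicators of
`|x| = w` at once with error `e^{-ℓ}` (`exists_random_weight_indicators`): the weight of a random
half of `x`, treated recursively, locates `|x|` up to `O(√(Mℓ))`, and interpolation finishes. With
`M = n + 1` and `ℓ` of the order of `log (1/ε)` this is the bound `O(√(n log (1/ε)))` for all
symmetric functions.

A bounded function `h` is a constant corrected at the weights `w < B` and `n - w` with `w < B`. The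
indicators of the weights `w < B` have to be correct at inputs of every weight, so the indicators
above, taken with `M = O(B + ℓ)`, are multiplied by a gap threshold, a random function which is `1`
at weights below `max B ℓ` and `0` at weights at least `M` (`exists_gap_threshold`). In
characteristic `p` it has degree `O(pℓ)`, as an exact threshold of `8ℓ` independent tests whether a
sparse random subset of `x` has cardinality prime to `p`. Over any field, a product over the dyadic
sampling densities gives degree `O(ℓ log n)`, which is the source of the logarithm in
characteristic zero.

Finally `f = g + h - 2gh` over the field combines the two parts, and for `ε ≥ 1/2`, where
`log (1/ε)` may be arbitrarily small, a random constant has error at most `ε`.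
-/

namespace SymPdeg

open scoped BigOperators

/-! ### Functions of low degree on the Boolean cube -/

/-- `φ` is the restriction to the Boolean cube of a polynomial of total degree at most `d`.
Working with functions on the cube instead of polynomials makes substitution of Boolean functions
a composition of functions. -/
def LowDeg {F : Type*} [Field F] {n : ℕ} (d : ℕ) (φ : (Fin n → Bool) → F) : Prop :=
  ∃ Q : MvPolynomial (Fin n) F, Q.totalDegree ≤ d ∧
    ∀ x, MvPolynomial.eval (fun i => toField F (x i)) Q = φ x

section LowDeg

variable {F : Type*} [Field F] {n : ℕ} {d e : ℕ} {φ ψ : (Fin n → Bool) → F}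

theorem LowDeg.mono (h : LowDeg d φ) (hde : d ≤ e) : LowDeg e φ := by
  obtain ⟨Q, hQ, hQ'⟩ := h
  exact ⟨Q, hQ.trans hde, hQ'⟩

theorem lowDeg_const (c : F) : LowDeg d (fun _ : Fin n → Bool => c) :=
  ⟨MvPolynomial.C c, by simp, by simp⟩

theorem lowDeg_coord (i : Fin n) : LowDeg 1 (fun x : Fin n → Bool => toField F (x i)) :=
  ⟨MvPolynomial.X i, by simp, by simp⟩

theorem LowDeg.add (h : LowDeg d φ) (h' : LowDeg d ψ) : LowDeg d (fun x => φ x + ψ x) := by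
  obtain ⟨Q, hQ, hQ'⟩ := h
  obtain ⟨R, hR, hR'⟩ := h'
  exact ⟨Q + R, (MvPolynomial.totalDegree_add _ _).trans (max_le hQ hR), by simp [hQ', hR']⟩

theorem LowDeg.mul (h : LowDeg d φ) (h' : LowDeg e ψ) : LowDeg (d + e) (fun x => φ x * ψ x) := by
  obtain ⟨Q, hQ, hQ'⟩ := h
  obtain ⟨R, hR, hR'⟩ := h'
  exact ⟨Q * R, (MvPolynomial.totalDegree_mul _ _).trans (add_le_add hQ hR), by simp [hQ', hR']⟩

theorem LowDeg.const_mul (h : LowDeg d φ) (c : F) : LowDeg d (fun x => c * φ x) := by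
  simpa using (lowDeg_const (d := 0) c).mul h

theorem LowDeg.sub (h : LowDeg d φ) (h' : LowDeg d ψ) : LowDeg d (fun x => φ x - ψ x) := by
  have := h.add (h'.const_mul (-1))
  simpa [sub_eq_add_neg] using this

theorem LowDeg.pow (h : LowDeg d φ) (k : ℕ) : LowDeg (k * d) (fun x => φ x ^ k) := by
  induction k with
  | zero => simpa using lowDeg_const (n := n) (d := 0) (1 : F)
  | succ k ih => simpa [pow_succ, add_mul] using ih.mul h

theorem lowDeg_sum {ι : Type*} (s : Finset ι) {φ : ι → (Fin n → Bool) → F}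
    (h : ∀ i ∈ s, LowDeg d (φ i)) : LowDeg d (fun x => ∑ i ∈ s, φ i x) := by
  classical
  induction s using Finset.induction_on with
  | empty => simpa using lowDeg_const (n := n) (0 : F)
  | insert a s ha ih =>
    simp only [Finset.sum_insert ha]
    exact (h a (by simp)).add (ih fun i hi => h i (by simp [hi]))

theorem lowDeg_prod {ι : Type*} (s : Finset ι) {φ : ι → (Fin n → Bool) → F} {d : ι → ℕ}
    (h : ∀ i ∈ s, LowDeg (d i) (φ i)) : LowDeg (∑ i ∈ s, d i) (fun x => ∏ i ∈ s, φ i x) := by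
  classical
  induction s using Finset.induction_on with
  | empty => simpa using lowDeg_const (n := n) (1 : F)
  | insert a s ha ih =>
    simp only [Finset.prod_insert ha, Finset.sum_insert ha]
    exact (h a (by simp)).mul (ih fun i hi => h i (by simp [hi]))

/-- Substituting Boolean functions of degree at most `e` multiplies the degree by at most `e`. -/
theorem LowDeg.comp {m : ℕ} {φ : (Fin m → Bool) → F} (h : LowDeg d φ)
    {y : (Fin n → Bool) → Fin m → Bool} (hy : ∀ k, LowDeg e (fun x => toField F (y x k))) :
    LowDeg (d * e) (fun x => φ (y x)) := by
  obtain ⟨Q, hQ, hQ'⟩ := h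
  have key : LowDeg (d * e) (fun x => ∑ u ∈ Q.support, Q.coeff u *
      ∏ i, toField F (y x i) ^ u i) := by
    refine lowDeg_sum _ fun u hu => LowDeg.const_mul ?_ _
    refine (lowDeg_prod Finset.univ fun i _ => (hy i).pow (u i)).mono ?_
    rw [← Finset.sum_mul]
    refine Nat.mul_le_mul_right _ (le_trans ?_ hQ)
    refine le_trans (le_of_eq ?_) (MvPolynomial.le_totalDegree hu)
    rw [Finsupp.sum_fintype _ _ (by simp)]
  convert key using 2 with x
  rw [← hQ', MvPolynomial.eval_eq']

/-- The bitwise conjunction of two Boolean vectors: `x` restricted to the coordinates in `s`. -/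
def mask (s x : Fin n → Bool) : Fin n → Bool := fun i => s i && x i

theorem LowDeg.comp_mask (h : LowDeg d φ) (s : Fin n → Bool) :
    LowDeg d (fun x => φ (mask s x)) := by
  rw [← mul_one d]
  refine h.comp (y := mask s) fun k => ?_
  cases hs : s k
  · simpa [mask, hs] using lowDeg_const (n := n) (d := 1) (toField F false)
  · simpa [mask, hs] using lowDeg_coord (F := F) k

theorem LowDeg.comp_not (h : LowDeg d φ) : LowDeg d (fun x => φ (fun i => !(x i))) := by
  rw [← mul_one d]
  refine h.comp (y := fun x i => !(x i)) fun k => ?_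
  have := (lowDeg_const (n := n) (d := 1) (1 : F)).sub (lowDeg_coord (F := F) k)
  convert this using 2 with x
  cases x k <;> simp [toField]

theorem weight_mask_le (s x : Fin n → Bool) : weight (mask s x) ≤ weight x := by
  refine Finset.card_le_card fun i => ?_
  simp only [Finset.mem_filter, Finset.mem_univ, true_and, mask, Bool.and_eq_true]
  exact fun h => h.2

theorem weight_not (x : Fin n → Bool) : weight (fun i => !(x i)) + weight x = n := by
  have := Finset.card_filter_add_card_filter_not (s := (Finset.univ : Finset (Fin n)))
    (fun i => x i = true)
  simp only [Finset.card_univ, Fintype.card_fin] at this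
  simp only [Bool.not_eq_true] at this
  simpa [weight, add_comm] using this

/-! ### Functions of the Hamming weight -/

/-- The `k`-th elementary symmetric polynomial takes the value `binom(|x|, k)` at `x`. -/
theorem lowDeg_choose_weight (k : ℕ) :
    LowDeg k (fun x : Fin n → Bool => ((weight x).choose k : F)) := by
  have key : LowDeg k (fun x : Fin n → Bool =>
      ∑ t ∈ Finset.powersetCard k Finset.univ, ∏ i ∈ t, toField F (x i)) := by
    refine lowDeg_sum _ fun t ht => ?_
    refine (lowDeg_prod t fun i _ => lowDeg_coord i).mono ?_
    simp [(Finset.mem_powersetCard.1 ht).2]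
  convert key using 2 with x
  have h1 : ∀ t : Finset (Fin n), ∏ i ∈ t, toField F (x i)
      = if t ⊆ Finset.univ.filter (fun i => x i = true) then 1 else 0 := by
    intro t
    split_ifs with h
    · refine Finset.prod_eq_one fun i hi => ?_
      have := h hi
      simp only [Finset.mem_filter, Finset.mem_univ, true_and] at this
      simp [toField, this]
    · obtain ⟨i, hi, hi'⟩ := Finset.not_subset.1 h
      refine Finset.prod_eq_zero hi ?_
      simp only [Finset.mem_filter, Finset.mem_univ, true_and] at hi'
      simp [toField, hi']
  simp only [h1]
  rw [Finset.sum_boole, weight, ← Finset.card_powersetCard]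
  congr 2
  ext t
  simp [Finset.mem_powersetCard, and_comm]

/-- Integer-valued interpolation: any function on `D + 1` consecutive naturals is a combination
of `binom(·, 0), …, binom(·, D)`. The induction on `D` passes to the forward difference, so it
needs no division and works in every characteristic. -/
theorem exists_choose_interpolation (D lo : ℕ) (s : ℕ → F) :
    ∃ c : ℕ → F, ∀ w, lo ≤ w → w ≤ lo + D →
      ∑ k ∈ Finset.range (D + 1), c k * (w.choose k : F) = s w := by
  induction D generalizing s with
  | zero =>
    refine ⟨fun _ => s lo, fun w h1 h2 => ?_⟩
    obtain rfl : w = lo := by omega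
    simp
  | succ D ih =>
    obtain ⟨c, hc⟩ := ih (fun w => s (w + 1) - s w)
    let S : ℕ → F := fun w => ∑ k ∈ Finset.range (D + 1), c k * (w.choose (k + 1) : F)
    refine ⟨fun k => Nat.casesOn k (s lo - S lo) c, fun w h1 h2 => ?_⟩
    rw [Finset.sum_range_succ']
    simp only [Nat.choose_zero_right, Nat.cast_one, mul_one]
    change S w + (s lo - S lo) = s w
    induction w, h1 using Nat.le_induction with
    | base => ring
    | succ w hw ihw =>
      have h3 := ihw (by omega)
      have h4 := hc w hw (by omega)
      have h5 : S (w + 1) = S w + ∑ k ∈ Finset.range (D + 1), c k * (w.choose k : F) := by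
        simp only [S, ← Finset.sum_add_distrib, ← mul_add]
        refine Finset.sum_congr rfl fun k _ => ?_
        rw [Nat.choose_succ_succ]
        push_cast
        ring
      rw [h5, h4]
      linear_combination h3

/-- Any function of the weight agrees, on the inputs with weight in `[lo, lo + D]`, with a
function of degree at most `D`. -/
theorem exists_lowDeg_interpolation (n D lo : ℕ) (s : ℕ → F) :
    ∃ φ : (Fin n → Bool) → F, LowDeg D φ ∧
      ∀ x, lo ≤ weight x → weight x ≤ lo + D → φ x = s (weight x) := by
  obtain ⟨c, hc⟩ := exists_choose_interpolation D lo s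
  refine ⟨fun x => ∑ k ∈ Finset.range (D + 1), c k * ((weight x).choose k : F), ?_, fun x => hc _⟩
  refine lowDeg_sum _ fun k hk => ((lowDeg_choose_weight k).mono ?_).const_mul _
  have := Finset.mem_range.1 hk
  omega

theorem lowDeg_weight (s : ℕ → F) : LowDeg n (fun x : Fin n → Bool => s (weight x)) := by
  obtain ⟨φ, hφ, h⟩ := exists_lowDeg_interpolation n n 0 s
  convert hφ using 2 with x
  rw [h x (Nat.zero_le _) (by simpa using weight_le x)]

theorem choose_add_prime_pow {p : ℕ} [CharP F p] (hp : p.Prime) (t i k : ℕ) (hk : k < p ^ t) :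
    ((i + p ^ t).choose k : F) = (i.choose k : F) := by
  rw [Nat.add_choose_eq, Nat.cast_sum, Finset.sum_eq_single (k, 0)]
  · simp
  · rintro ⟨a, b⟩ hab hne
    have hab' := Finset.HasAntidiagonal.mem_antidiagonal.1 hab
    simp only at hab'
    have hb : b ≠ 0 := by
      rintro rfl
      exact hne (by simp_all)
    have := (CharP.cast_eq_zero_iff F p _).2 (hp.dvd_choose_pow (n := t) hb (by omega))
    push_cast
    rw [this, mul_zero]
  · simp

/-- In characteristic `p`, binomial coefficients `binom(·, k)` with `k < p ^ t` have period `p ^ t`,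
so a function of the weight with period `p ^ t` has degree less than `p ^ t`. -/
theorem lowDeg_of_periodic {p : ℕ} [CharP F p] (hp : p.Prime) (t : ℕ) (s : ℕ → F)
    (hs : ∀ i, i + p ^ t ≤ n → s i = s (i + p ^ t)) :
    LowDeg (p ^ t - 1) (fun x : Fin n → Bool => s (weight x)) := by
  have hq : 0 < p ^ t := pow_pos hp.pos t
  obtain ⟨c, hc⟩ := exists_choose_interpolation (p ^ t - 1) 0 s
  rw [Nat.sub_add_cancel hq] at hc
  have key : ∀ w, w ≤ n → ∑ k ∈ Finset.range (p ^ t), c k * (w.choose k : F) = s w := by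
    intro w
    induction w using Nat.strong_induction_on with
    | _ w ih =>
      intro hw
      by_cases h : w < p ^ t
      · exact hc w (Nat.zero_le _) (by omega)
      · obtain ⟨i, rfl⟩ : ∃ i, w = i + p ^ t := ⟨w - p ^ t, by omega⟩
        rw [← hs i hw, ← ih i (by omega) (by omega)]
        refine Finset.sum_congr rfl fun k hk => ?_
        rw [choose_add_prime_pow hp t i k (Finset.mem_range.1 hk)]
  have : LowDeg (p ^ t - 1) (fun x : Fin n → Bool =>
      ∑ k ∈ Finset.range (p ^ t), c k * ((weight x).choose k : F)) := by
    refine lowDeg_sum _ fun k hk => ((lowDeg_choose_weight k).mono ?_).const_mul _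
    have := Finset.mem_range.1 hk
    omega
  convert this using 2 with x
  exact (key _ (weight_le x)).symm

end LowDeg

/-! ### Uniform probability on finite types -/

open Classical in
/-- The probability of the event `E` under the uniform distribution on the finite type `Ω`. -/
noncomputable def prob {Ω : Type*} [Fintype Ω] (E : Ω → Prop) : ℝ :=
  𝔼 ω, if E ω then (1 : ℝ) else 0

section Prob

variable {Ω Ω' : Type*} [Fintype Ω] [Fintype Ω']

theorem prob_eq_card_div (E : Ω → Prop) [DecidablePred E] :
    prob E = ((Finset.univ.filter E).card : ℝ) / Fintype.card Ω := by
  classical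
  rw [prob, Fintype.expect_eq_sum_div_card, ← Finset.sum_boole]
  congr!

theorem prob_mono {E E' : Ω → Prop} (h : ∀ ω, E ω → E' ω) : prob E ≤ prob E' := by
  refine Finset.expect_le_expect fun ω _ => ?_
  by_cases hE : E ω
  · simp [hE, h ω hE]
  · simp only [hE, if_false]
    split_ifs <;> norm_num

theorem prob_nonneg (E : Ω → Prop) : 0 ≤ prob E :=
  Finset.expect_nonneg fun ω _ => by split_ifs <;> norm_num

theorem prob_le_one [Nonempty Ω] (E : Ω → Prop) : prob E ≤ 1 :=
  Finset.expect_le Finset.univ_nonempty fun ω _ => by split_ifs <;> norm_num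

theorem prob_eq_zero {E : Ω → Prop} (h : ∀ ω, ¬ E ω) : prob E = 0 := by
  simp [prob, h]

theorem prob_or_le (E E' : Ω → Prop) : prob (fun ω => E ω ∨ E' ω) ≤ prob E + prob E' := by
  rw [prob, prob, prob, ← Finset.expect_add_distrib]
  refine Finset.expect_le_expect fun ω _ => ?_
  by_cases h : E ω <;> by_cases h' : E' ω <;> simp [h, h']

theorem prob_le_expect {E : Ω → Prop} (f : Ω → ℝ) (h0 : ∀ ω, 0 ≤ f ω) (h1 : ∀ ω, E ω → 1 ≤ f ω) :
    prob E ≤ 𝔼 ω, f ω := by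
  refine Finset.expect_le_expect fun ω _ => ?_
  split_ifs with h
  · exact h1 ω h
  · exact h0 ω

/-- If an equivalence of the sample space takes `E` into its complement, then `E` has probability
at most one half. -/
theorem prob_le_half_of_equiv [Nonempty Ω] {E : Ω → Prop} (σ : Ω ≃ Ω) (h : ∀ ω, E ω → ¬ E (σ ω)) :
    prob E ≤ 1 / 2 := by
  have h1 : prob E = prob (fun ω => E (σ ω)) :=
    (Fintype.expect_equiv σ _ _ fun ω => rfl).symm
  have h2 : prob E + prob (fun ω => E (σ ω)) ≤ 1 := by
    rw [prob, prob, ← Finset.expect_add_distrib]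
    refine Finset.expect_le Finset.univ_nonempty fun ω _ => ?_
    by_cases hE : E ω
    · simp [hE, h ω hE]
    · simp only [hE, if_false, zero_add]
      split_ifs <;> norm_num
  linarith

theorem prob_prod_eq (E : Ω × Ω' → Prop) :
    prob E = 𝔼 ω : Ω, prob (fun ω' : Ω' => E (ω, ω')) := by
  classical
  simp only [prob]
  rw [← Finset.univ_product_univ, Finset.expect_product]

theorem prob_fst [Nonempty Ω'] (E : Ω → Prop) :
    prob (fun ω : Ω × Ω' => E ω.1) = prob E := by
  rw [prob_prod_eq]
  simp only [prob]
  refine Finset.expect_congr rfl fun ω _ => ?_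
  by_cases h : E ω <;> simp [h]

theorem prob_snd [Nonempty Ω] (E : Ω' → Prop) :
    prob (fun ω : Ω × Ω' => E ω.2) = prob E := by
  rw [prob_prod_eq]
  exact Fintype.expect_const (ι := Ω) (prob E)

/-- Union bound for a two-stage experiment: the first stage leaves the good event `G` with
probability at most `a`, and after a good first stage the second one fails with probability at
most `b`. -/
theorem prob_prod_le [Nonempty Ω] [Nonempty Ω'] {E : Ω × Ω' → Prop} {G : Ω → Prop} {a b : ℝ}
    (hG : prob (fun ω => ¬ G ω) ≤ a) (hb : 0 ≤ b)
    (hE : ∀ ω, G ω → prob (fun ω' => E (ω, ω')) ≤ b) : prob E ≤ a + b := by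
  classical
  have h1 : prob E ≤ 𝔼 ω : Ω, ((if ¬ G ω then (1 : ℝ) else 0) + b) := by
    rw [prob_prod_eq]
    refine Finset.expect_le_expect fun ω _ => ?_
    by_cases h : G ω
    · simpa [h] using hE ω h
    · simpa [h] using (prob_le_one _).trans (by linarith)
  rw [Finset.expect_add_distrib, Fintype.expect_const] at h1
  refine h1.trans (add_le_add_left ?_ b)
  refine le_of_eq_of_le ?_ hG
  rw [prob]
  congr!

theorem expect_prod_pi {ι : Type*} [Fintype ι] [DecidableEq ι] (f : ι → Ω → ℝ) :
    𝔼 ω : ι → Ω, ∏ i, f i (ω i) = ∏ i, 𝔼 a, f i a := by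
  simp only [Fintype.expect_eq_sum_div_card]
  rw [Finset.prod_div_distrib, Finset.prod_univ_sum]
  simp

/-- The probability generating function of a binomial distribution: sample `ω i ∈ Ω`
independently; the number of `i` in the support of `x` with `E (ω i)` is binomial with parameters
`|x|` and `prob E`. -/
theorem expect_pow_card [Nonempty Ω] {n : ℕ} (x : Fin n → Bool) (E : Ω → Prop) [DecidablePred E]
    (z : ℝ) :
    𝔼 ω : Fin n → Ω, z ^ weight (fun i => decide (E (ω i)) && x i)
      = (1 + (z - 1) * prob E) ^ weight x := by
  classical
  have h1 : ∀ ω : Fin n → Ω, z ^ weight (fun i => decide (E (ω i)) && x i)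
      = ∏ i, if x i then (if E (ω i) then z else 1) else 1 := by
    intro ω
    rw [weight, ← Finset.prod_const, Finset.prod_filter]
    refine Finset.prod_congr rfl fun i _ => ?_
    by_cases hE : E (ω i) <;> cases x i <;> simp [hE]
  have h2 : 𝔼 a : Ω, (if E a then z else 1) = 1 + (z - 1) * prob E := by
    have : ∀ a : Ω, (if E a then z else 1) = 1 + (z - 1) * (if E a then (1 : ℝ) else 0) := by
      intro a; split_ifs <;> ring
    simp only [this]
    rw [Finset.expect_add_distrib, Fintype.expect_const, ← Finset.mul_expect, prob]
    congr!
  simp only [h1]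
  rw [expect_prod_pi (fun i a => if x i then (if E a then z else 1) else 1), weight,
    ← Finset.prod_const, Finset.prod_filter]
  refine Finset.prod_congr rfl fun i _ => ?_
  cases x i
  · simp
  · simpa using h2

/-- Chernoff bound for the upper tail of a binomial distribution. -/
theorem prob_le_card_le [Nonempty Ω] {n : ℕ} (x : Fin n → Bool) (E : Ω → Prop) [DecidablePred E]
    {z : ℝ} (hz : 1 ≤ z) (u : ℕ) :
    prob (fun ω : Fin n → Ω => u ≤ weight (fun i => decide (E (ω i)) && x i))
      ≤ (1 + (z - 1) * prob E) ^ weight x / z ^ u := by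
  have h0 : (0 : ℝ) < z ^ u := by positivity
  rw [← expect_pow_card x E z, Finset.expect_div]
  refine prob_le_expect _ (fun ω => by positivity) fun ω h => ?_
  rw [le_div_iff₀ h0, one_mul]
  exact pow_le_pow_right₀ hz h

/-- Chernoff bound for the lower tail of a binomial distribution. -/
theorem prob_card_le_le [Nonempty Ω] {n : ℕ} (x : Fin n → Bool) (E : Ω → Prop) [DecidablePred E]
    {z : ℝ} (hz : 0 < z) (hz1 : z ≤ 1) (u : ℕ) :
    prob (fun ω : Fin n → Ω => weight (fun i => decide (E (ω i)) && x i) ≤ u)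
      ≤ (1 + (z - 1) * prob E) ^ weight x / z ^ u := by
  have h0 : (0 : ℝ) < z ^ u := by positivity
  rw [← expect_pow_card x E z, Finset.expect_div]
  refine prob_le_expect _ (fun ω => by positivity) fun ω h => ?_
  rw [le_div_iff₀ h0, one_mul]
  exact pow_le_pow_of_le_one hz.le hz1 h

theorem exp_neg_add_one_add_self_le {ℓ : ℝ} :
    Real.exp (-(ℓ + 1)) + Real.exp (-(ℓ + 1)) ≤ Real.exp (-ℓ) := by
  have h : Real.exp (-ℓ) = Real.exp 1 * Real.exp (-(ℓ + 1)) := by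
    rw [← Real.exp_add]; congr 1; ring
  have h2 : (2 : ℝ) ≤ Real.exp 1 := by
    have := Real.add_one_le_exp (1 : ℝ); linarith
  rw [h]
  nlinarith [Real.exp_pos (-(ℓ + 1))]

/-- Hoeffding's inequality for a uniformly random restriction of `x`. -/
theorem prob_halving_deviation {n : ℕ} (x : Fin n → Bool) {M Δ ℓ : ℝ} (hM : 0 < M)
    (hx : (weight x : ℝ) ≤ M) (hΔ0 : 0 ≤ Δ) (hΔ : 2 * M * (ℓ + 1) ≤ Δ ^ 2) :
    prob (fun s : Fin n → Bool => ¬ |2 * (weight (mask s x) : ℝ) - weight x| ≤ Δ)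
      ≤ Real.exp (-ℓ) := by
  have hhalf : prob (fun b : Bool => b = true) = 1 / 2 := by
    have : (Finset.univ.filter fun b : Bool => b = true) = {true} := by decide
    rw [prob_eq_card_div, this]; simp
  -- Exponential moments of both signs; `t = Δ / M` is the optimal parameter.
  have key : ∀ t : ℝ, 𝔼 s : Fin n → Bool,
      Real.exp (t * (2 * (weight (mask s x) : ℝ) - weight x)) ≤ Real.exp (t ^ 2 * M / 2) := by
    intro t
    have h1 : ∀ s : Fin n → Bool, Real.exp (t * (2 * (weight (mask s x) : ℝ) - weight x))
        = Real.exp (-t) ^ weight x *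
          Real.exp (2 * t) ^ weight (fun i => decide (s i = true) && x i) := by
      intro s
      rw [← Real.exp_nat_mul, ← Real.exp_nat_mul, ← Real.exp_add]
      have : (fun i => decide (s i = true) && x i) = mask s x := by ext i; simp [mask]
      rw [this]
      congr 1
      ring
    simp only [h1]
    rw [← Finset.mul_expect, expect_pow_card x (fun b : Bool => b = true), hhalf, ← mul_pow]
    have h2 : Real.exp (-t) * (1 + (Real.exp (2 * t) - 1) * (1 / 2)) = Real.cosh t := by
      rw [Real.cosh_eq]
      have : Real.exp (2 * t) = Real.exp t * Real.exp t := by rw [← Real.exp_add]; congr 1; ring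
      have h3 : Real.exp (-t) * Real.exp t = 1 := by rw [← Real.exp_add]; simp
      rw [this]
      linear_combination (Real.exp t / 2) * h3
    rw [h2]
    calc Real.cosh t ^ weight x ≤ Real.exp (t ^ 2 / 2) ^ weight x :=
          pow_le_pow_left₀ (Real.cosh_pos t).le (Real.cosh_le_exp_half_sq t) _
      _ = Real.exp (weight x * (t ^ 2 / 2)) := by rw [Real.exp_nat_mul]
      _ ≤ Real.exp (t ^ 2 * M / 2) := by
          refine Real.exp_le_exp.2 ?_
          nlinarith [sq_nonneg t]
  have tail : ∀ σ : ℝ, σ ^ 2 = 1 → prob (fun s : Fin n → Bool =>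
      Δ < σ * (2 * (weight (mask s x) : ℝ) - weight x)) ≤ Real.exp (-(ℓ + 1)) := by
    intro σ hσ
    have h0 : 0 ≤ Δ / M := by positivity
    calc prob (fun s : Fin n → Bool => Δ < σ * (2 * (weight (mask s x) : ℝ) - weight x))
        ≤ 𝔼 s : Fin n → Bool, Real.exp (-(Δ / M * Δ)) *
            Real.exp ((σ * (Δ / M)) * (2 * (weight (mask s x) : ℝ) - weight x)) := by
          refine prob_le_expect _ (fun ω => by positivity) fun s hs => ?_
          rw [← Real.exp_add]
          refine Real.one_le_exp ?_
          have := mul_le_mul_of_nonneg_left hs.le h0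
          linarith
      _ ≤ Real.exp (-(Δ / M * Δ)) * Real.exp ((σ * (Δ / M)) ^ 2 * M / 2) := by
          rw [← Finset.mul_expect]
          exact mul_le_mul_of_nonneg_left (key _) (Real.exp_pos _).le
      _ ≤ Real.exp (-(ℓ + 1)) := by
          rw [← Real.exp_add]
          refine Real.exp_le_exp.2 ?_
          have h3 : -(Δ / M * Δ) + (σ * (Δ / M)) ^ 2 * M / 2 = -(Δ ^ 2 / (2 * M)) := by
            rw [mul_pow, hσ]
            field_simp
            ring
          rw [h3, neg_le_neg_iff, le_div_iff₀ (by positivity)]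
          linarith
  calc prob (fun s : Fin n → Bool => ¬ |2 * (weight (mask s x) : ℝ) - weight x| ≤ Δ)
      ≤ prob (fun s : Fin n → Bool => Δ < 1 * (2 * (weight (mask s x) : ℝ) - weight x) ∨
          Δ < -1 * (2 * (weight (mask s x) : ℝ) - weight x)) := by
        refine prob_mono fun s hs => ?_
        rw [not_le, lt_abs] at hs
        simpa using hs
    _ ≤ Real.exp (-(ℓ + 1)) + Real.exp (-(ℓ + 1)) :=
        (prob_or_le _ _).trans (add_le_add (tail 1 (by norm_num)) (tail (-1) (by norm_num)))
    _ ≤ Real.exp (-ℓ) := exp_neg_add_one_add_self_le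

end Prob

/-! ### Random indicators of the weight -/

/-- Random low-degree functions `R w` which, at every input of weight less than `M`, compute the
indicators of all weights *simultaneously*, with probability `1 - e^{-ℓ}`.

Let `x'` be `x` restricted to a random set of coordinates. Then `2|x'|` is within
`Δ = O(√(Mℓ))` of `|x|`, so once `|x'| = w'` is known, the indicator of `|x| = w` is found by exact
interpolation on an interval of length `2Δ`. Indicators for `x'` come from the same
construction with `M` replaced by at most `3M/4`. Since the degrees `2Δ` add up along the recursion
and decrease geometrically, the total is `O(√(Mℓ) + ℓ)`. -/
theorem exists_random_weight_indicators (F : Type*) [Field F] (n M ℓ : ℕ) (hℓ : 10 ≤ ℓ) :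
    ∃ (Ω : Type) (_ : Fintype Ω) (_ : Nonempty Ω) (R : Ω → ℕ → (Fin n → Bool) → F) (d : ℕ),
      (d : ℝ) ≤ 256 * (√(M * ℓ) + ℓ) ∧ (∀ ω w, LowDeg d (R ω w)) ∧
      ∀ x, weight x < M →
        prob (fun ω => ∃ w, R ω w x ≠ if weight x = w then 1 else 0) ≤ Real.exp (-ℓ) := by
  induction M using Nat.strong_induction_on generalizing ℓ with
  | _ M ih =>
  by_cases hM : M ≤ 256 * ℓ
  · choose P hP hP' using fun w : ℕ =>
      exists_lowDeg_interpolation (F := F) n M 0 (fun v => if v = w then 1 else 0)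
    refine ⟨Unit, inferInstance, inferInstance, fun _ => P, M, ?_, fun _ => hP, fun x hx => ?_⟩
    · have : (M : ℝ) ≤ 256 * ℓ := by exact_mod_cast hM
      have := Real.sqrt_nonneg ((M : ℝ) * ℓ)
      linarith
    · rw [prob_eq_zero]
      · exact (Real.exp_pos _).le
      · rintro _ ⟨w, hw⟩
        exact hw (hP' w x (Nat.zero_le _) (by omega))
  · rw [not_le] at hM
    have hℓR : (10 : ℝ) ≤ ℓ := by exact_mod_cast hℓ
    have hMR : (256 : ℝ) * ℓ < M := by exact_mod_cast hM
    set Z : ℝ := √(M * ℓ) with hZ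
    have hZsq : Z ^ 2 = M * ℓ := Real.sq_sqrt (by positivity)
    have hZ0 : 0 ≤ Z := Real.sqrt_nonneg _
    have hZℓ : 16 * (ℓ : ℝ) ≤ Z := Real.le_sqrt_of_sq_le (by nlinarith)
    have hZM : Z ≤ M / 16 := Real.sqrt_le_iff.2 ⟨by positivity, by nlinarith⟩
    set Δ : ℕ := ⌈2 * Z⌉₊ with hΔ
    have hΔ1 : 2 * Z ≤ Δ := Nat.le_ceil _
    have hΔ2 : (Δ : ℝ) ≤ 3 * Z := by
      have := Nat.ceil_lt_add_one (a := 2 * Z) (by positivity)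
      linarith
    set M' : ℕ := (M + Δ) / 2 + 1 with hM'
    have hM'R : (M' : ℝ) ≤ 3 / 4 * M := by
      have h1 : (((M + Δ) / 2 : ℕ) : ℝ) ≤ ((M + Δ : ℕ) : ℝ) / 2 := Nat.cast_div_le
      rw [hM']
      push_cast at h1 ⊢
      linarith
    have hlt : M' < M := by
      have : (M' : ℝ) < M := by linarith
      exact_mod_cast this
    obtain ⟨Ω, _, _, R, d, hd, hR, hR'⟩ := ih M' hlt (ℓ + 1) (by omega)
    choose P hP hP' using fun w' w : ℕ =>
      exists_lowDeg_interpolation (F := F) n (2 * Δ) (2 * w' - Δ) (fun v => if v = w then 1 else 0)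
    refine ⟨(Fin n → Bool) × Ω, inferInstance, inferInstance,
      fun ω w x => ∑ w' ∈ Finset.range (n + 1), R ω.2 w' (mask ω.1 x) * P w' w x,
      d + 2 * Δ, ?_, fun ω w => ?_, fun x hx => ?_⟩
    · have h1 : √((M' : ℝ) * ((ℓ + 1 : ℕ) : ℝ)) ≤ 0.91 * Z := by
        refine Real.sqrt_le_iff.2 ⟨by positivity, ?_⟩
        rw [mul_pow, hZsq]
        push_cast
        have h2 : (M' : ℝ) * (ℓ + 1) ≤ 3 / 4 * M * (1.1 * ℓ) :=
          mul_le_mul hM'R (by linarith) (by positivity) (by positivity)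
        nlinarith
      push_cast at hd h1 ⊢
      linarith
    · exact lowDeg_sum _ fun w' _ => ((hR _ _).comp_mask _).mul (hP _ _)
    · have hxM : (weight x : ℝ) < M := by exact_mod_cast hx
      have hdev := prob_halving_deviation x (M := M) (Δ := Δ) (ℓ := (ℓ : ℝ) + 1)
        (by linarith) hxM.le (by positivity) (by nlinarith)
      refine (prob_prod_le hdev (Real.exp_pos (-((ℓ : ℝ) + 1))).le fun s hs => ?_).trans
        exp_neg_add_one_add_self_le
      rw [abs_le] at hs
      have h1 : 2 * weight (mask s x) ≤ weight x + Δ := by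
        have : (2 : ℝ) * weight (mask s x) ≤ weight x + Δ := by linarith [hs.2]
        exact_mod_cast this
      have h2 : weight x ≤ 2 * weight (mask s x) + Δ := by
        have : (weight x : ℝ) ≤ 2 * weight (mask s x) + Δ := by linarith [hs.1]
        exact_mod_cast this
      have h3 := hR' (mask s x) (by omega)
      push_cast at h3
      refine (prob_mono fun ω hω => ?_).trans h3
      by_contra hgood
      push Not at hgood
      obtain ⟨w, hw⟩ := hω
      apply hw
      simp only [hgood]
      rw [Finset.sum_eq_single (weight (mask s x))]
      · rw [if_pos rfl, one_mul, hP' _ _ _ (by omega) (by omega)]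
      · intro w' _ hne
        rw [if_neg (Ne.symm hne), zero_mul]
      · intro h
        exact absurd (Finset.mem_range.2 (Nat.lt_succ_of_le (weight_le _))) h

/-! ### Gap thresholds in positive characteristic -/

theorem one_add_pow_le_exp {a : ℝ} (ha : 0 ≤ 1 + a) (w : ℕ) : (1 + a) ^ w ≤ Real.exp (a * w) := by
  rw [mul_comm, Real.exp_nat_mul]
  exact pow_le_pow_left₀ ha (by linarith [Real.add_one_le_exp a]) w

/-- Switching one coordinate of a random set changes the weight of the restriction by one. -/
theorem weight_mask_update {n : ℕ} (s y : Fin n → Bool) {i : Fin n} (hi : y i = true) :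
    weight (mask (Function.update s i true) y)
      = weight (mask (Function.update s i false) y) + 1 := by
  classical
  have h : (Finset.univ.filter fun k => mask (Function.update s i true) y k = true)
      = insert i (Finset.univ.filter fun k => mask (Function.update s i false) y k = true) := by
    ext k
    by_cases hk : k = i
    · subst hk; simp [mask, hi]
    · simp [mask, hk]
  rw [weight, h, Finset.card_insert_of_notMem (by simp [mask]), weight]

/-- A random subset of a nonempty set has cardinality divisible by `p` with probability at most
one half. -/
theorem prob_dvd_weight_mask_le {n p : ℕ} (hp : p.Prime) (y : Fin n → Bool) (hy : weight y ≠ 0) :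
    prob (fun s : Fin n → Bool => p ∣ weight (mask s y)) ≤ 1 / 2 := by
  obtain ⟨i, hi⟩ : ∃ i, y i = true := by
    by_contra h
    push Not at h
    exact hy (by simp [weight, h])
  have hinv : Function.Involutive (fun s : Fin n → Bool => Function.update s i (!(s i))) := by
    intro s; simp
  refine prob_le_half_of_equiv hinv.toPerm fun s h1 h2 => ?_
  have h3 := weight_mask_update s y hi
  have h4 : p ∣ 1 := by
    cases hs : s i
    · have h5 : s = Function.update s i false := by rw [← hs]; simp
      simp only [Function.Involutive.coe_toPerm, hs, Bool.not_false] at h2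
      rw [h5] at h1
      rw [h3] at h2
      exact (Nat.dvd_add_right h1).1 h2
    · have h5 : s = Function.update s i true := by rw [← hs]; simp
      simp only [Function.Involutive.coe_toPerm, hs, Bool.not_true] at h2
      rw [h5, h3] at h1
      exact (Nat.dvd_add_right h2).1 h1
  exact hp.one_lt.ne' (Nat.dvd_one.1 h4)

/-- The indicator that `p` does not divide `|s ∧ r ∧ x|`. In characteristic `p` it has degree
`p - 1`, by Fermat's little theorem. -/
def modTest {n : ℕ} (p : ℕ) (s r x : Fin n → Bool) : Bool :=
  decide (¬ p ∣ weight (mask s (mask r x)))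

theorem lowDeg_modTest {F : Type*} [Field F] {n p : ℕ} [CharP F p] (hp : p.Prime)
    (s r : Fin n → Bool) : LowDeg (p - 1) (fun x => toField F (modTest p s r x)) := by
  have h := ((((lowDeg_choose_weight (F := F) (n := n) 1).comp_mask s).comp_mask r)).pow (p - 1)
  rw [mul_one] at h
  convert h using 2 with x
  rw [Nat.choose_one_right, modTest]
  by_cases hd : p ∣ weight (mask s (mask r x))
  · rw [(CharP.cast_eq_zero_iff F p _).2 hd, zero_pow (Nat.sub_ne_zero_of_lt hp.one_lt)]
    simp [hd, toField]
  · have h1 := Nat.ModEq.pow_totient ((Nat.Prime.coprime_iff_not_dvd hp).2 hd).symm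
    rw [Nat.totient_prime hp] at h1
    have h2 := (CharP.natCast_eq_natCast F p).2 h1
    push_cast at h2
    rw [h2]
    simp [hd, toField]

theorem prob_fin_val_lt {N k : ℕ} (hk : k ≤ N) :
    prob (fun a : Fin N => a.val < k) = (k : ℝ) / N := by
  rw [prob_eq_card_div, Fin.card_filter_val_lt, min_eq_right hk, Fintype.card_fin]

/-- With a sparse set `r` of density `1 / (256 B)`, the test rarely fires on inputs of weight
below `B`. -/
theorem prob_modTest_le {n p B : ℕ} (hB : 1 ≤ B) (x : Fin n → Bool) (hx : weight x < B) :
    prob (fun ω : (Fin n → Fin (256 * B)) × (Fin n → Bool) =>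
      modTest p ω.2 (fun i => decide ((ω.1 i).val < 1)) x = true) ≤ 1 / 64 := by
  have : Nonempty (Fin (256 * B)) := ⟨⟨0, by omega⟩⟩
  have hBR : (1 : ℝ) ≤ B := by exact_mod_cast hB
  have hxR : (weight x : ℝ) ≤ B := by exact_mod_cast hx.le
  calc _ ≤ prob (fun ω : (Fin n → Fin (256 * B)) × (Fin n → Bool) =>
        1 ≤ weight (fun i => decide ((ω.1 i).val < 1) && x i)) := by
        refine prob_mono fun ω hω => ?_
        by_contra h
        have h0 : weight (mask (fun i => decide ((ω.1 i).val < 1)) x) = 0 :=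
          Nat.lt_one_iff.1 (not_le.1 h)
        have h1 := weight_mask_le ω.2 (mask (fun i => decide ((ω.1 i).val < 1)) x)
        rw [h0, Nat.le_zero] at h1
        simp only [modTest, h1] at hω
        simp at hω
    _ = prob (fun η : Fin n → Fin (256 * B) =>
        1 ≤ weight (fun i => decide ((η i).val < 1) && x i)) :=
        prob_fst (fun η : Fin n → Fin (256 * B) =>
          1 ≤ weight (fun i => decide ((η i).val < 1) && x i))
    _ ≤ _ := prob_le_card_le x (fun a : Fin (256 * B) => a.val < 1) (z := 257) (by norm_num) 1
    _ ≤ 3 / 257 := by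
        rw [prob_fin_val_lt (by omega), pow_one]
        refine div_le_div_of_nonneg_right ?_ (by norm_num)
        refine (one_add_pow_le_exp (by positivity) _).trans ?_
        have h2 : (257 - 1) * (((1 : ℕ) : ℝ) / ((256 * B : ℕ) : ℝ)) * (weight x : ℝ) ≤ 1 := by
          push_cast
          rw [show (257 - 1 : ℝ) * (1 / (256 * B)) * weight x = weight x / B by
            field_simp; norm_num]
          exact (div_le_one (by positivity)).2 hxR
        refine (Real.exp_le_exp.2 h2).trans ?_
        linarith [Real.exp_one_lt_d9]
    _ ≤ 1 / 64 := by norm_num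

/-- The test fires with probability almost one half on inputs of large weight. -/
theorem prob_modTest_eq_false_le {n p B : ℕ} (hp : p.Prime) (hB : 1 ≤ B) (x : Fin n → Bool)
    (hx : 2560 * B ≤ weight x) :
    prob (fun ω : (Fin n → Fin (256 * B)) × (Fin n → Bool) =>
      modTest p ω.2 (fun i => decide ((ω.1 i).val < 1)) x = false) ≤ 33 / 64 := by
  have : Nonempty (Fin (256 * B)) := ⟨⟨0, by omega⟩⟩
  have hBR : (1 : ℝ) ≤ B := by exact_mod_cast hB
  have hxR : 2560 * (B : ℝ) ≤ weight x := by exact_mod_cast hx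
  have hmiss : prob (fun η : Fin n → Fin (256 * B) =>
      ¬ weight (mask (fun i => decide ((η i).val < 1)) x) ≠ 0) ≤ 1 / 64 := by
    calc _ ≤ prob (fun η : Fin n → Fin (256 * B) =>
          weight (fun i => decide ((η i).val < 1) && x i) ≤ 0) := by
          refine prob_mono fun η h => ?_
          rw [not_not] at h
          exact h.le
      _ ≤ _ := prob_card_le_le x (fun a : Fin (256 * B) => a.val < 1) (z := 1 / 2) (by norm_num)
          (by norm_num) 0
      _ ≤ Real.exp (-5) := by
          rw [prob_fin_val_lt (by omega), pow_zero, div_one]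
          have h1 : ((1 : ℕ) : ℝ) / ((256 * B : ℕ) : ℝ) ≤ 1 := by
            rw [div_le_one (by positivity)]
            push_cast
            linarith
          refine (one_add_pow_le_exp (by linarith) _).trans (Real.exp_le_exp.2 ?_)
          push_cast
          rw [show ((1 / 2 : ℝ) - 1) * (1 / (256 * B)) * weight x = -(weight x / (512 * B)) by
            field_simp; ring, neg_le_neg_iff, le_div_iff₀ (by positivity)]
          linarith
      _ ≤ 1 / 64 := by
          rw [Real.exp_neg, ← one_div]
          refine one_div_le_one_div_of_le (by norm_num) ?_
          have h2 : Real.exp 5 = Real.exp 1 ^ 5 := by rw [← Real.exp_nat_mul]; norm_num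
          rw [h2]
          have h3 : (2.7 : ℝ) ≤ Real.exp 1 := by linarith [Real.exp_one_gt_d9]
          exact le_trans (by norm_num) (pow_le_pow_left₀ (by norm_num) h3 5)
  refine (prob_prod_le hmiss (b := 1 / 2) (by norm_num) fun η hη => ?_).trans (by norm_num)
  refine (prob_mono fun s hs => ?_).trans (prob_dvd_weight_mask_le hp _ hη)
  simpa [modTest] using hs

/-- Among `8 ℓ` independent trials of an event of probability at most `δ`, where
`(1 + 15 δ)^8 ≤ 16^r / e`, at least `r ℓ` succeed with probability at most `e^{-ℓ}`. -/
theorem prob_many_successes_le {Ω : Type*} [Fintype Ω] [Nonempty Ω] (E : Ω → Prop)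
    [DecidablePred E] {δ : ℝ} (hE : prob E ≤ δ) (r ℓ : ℕ)
    (hδ : (1 + 15 * δ) ^ 8 * Real.exp 1 ≤ 16 ^ r) :
    prob (fun ω : Fin (8 * ℓ) → Ω => r * ℓ ≤ weight (fun k => decide (E (ω k)))) ≤
      Real.exp (-ℓ) := by
  have h := prob_le_card_le (fun _ : Fin (8 * ℓ) => true) E (z := 16) (by norm_num) (r * ℓ)
  simp only [Bool.and_true] at h
  refine h.trans ?_
  have hw : weight (fun _ : Fin (8 * ℓ) => true) = 8 * ℓ := by simp [weight]
  have h0 := prob_nonneg E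
  rw [hw, pow_mul, pow_mul, ← div_pow, show -(ℓ : ℝ) = ℓ * (-1) by ring, Real.exp_nat_mul]
  refine pow_le_pow_left₀ (by positivity) ?_ ℓ
  rw [div_le_iff₀ (by positivity), Real.exp_neg, inv_mul_eq_div, le_div_iff₀ (Real.exp_pos 1)]
  refine le_trans (mul_le_mul_of_nonneg_right ?_ (Real.exp_pos 1).le) hδ
  exact pow_le_pow_left₀ (by linarith) (by linarith) 8

/-- In characteristic `p`, weights below `B` are separated from weights at least `2560 B` in degree
`O(pℓ)`, with error `e^{-ℓ}`: take `8ℓ` independent copies of the test `modTest` and ask, by an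
exact symmetric polynomial, whether fewer than `ℓ` of them fire. -/
theorem exists_gap_threshold_of_prime (F : Type*) [Field F] {p : ℕ} [CharP F p] (hp : p.Prime)
    (n ℓ : ℕ) {B : ℕ} (hB : 1 ≤ B) :
    ∃ (Ω : Type) (_ : Fintype Ω) (_ : Nonempty Ω) (T : Ω → (Fin n → Bool) → F),
      (∀ ω, LowDeg (8 * ℓ * (p - 1)) (T ω)) ∧
      (∀ x, weight x < B → prob (fun ω => T ω x ≠ 1) ≤ Real.exp (-ℓ)) ∧
      ∀ x, 2560 * B ≤ weight x → prob (fun ω => T ω x ≠ 0) ≤ Real.exp (-ℓ) := by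
  have : Nonempty (Fin (256 * B)) := ⟨⟨0, by omega⟩⟩
  let Y : (Fin n → Fin (256 * B)) × (Fin n → Bool) → (Fin n → Bool) → Bool :=
    fun ω => modTest p ω.2 (fun i => decide ((ω.1 i).val < 1))
  have he := Real.exp_one_lt_d9
  refine ⟨Fin (8 * ℓ) → (Fin n → Fin (256 * B)) × (Fin n → Bool), inferInstance, inferInstance,
    fun ω x => if weight (fun k => Y (ω k) x) < ℓ then 1 else 0, fun ω => ?_, fun x hx => ?_,
    fun x hx => ?_⟩
  · exact (lowDeg_weight (n := 8 * ℓ) (fun v => if v < ℓ then (1 : F) else 0)).comp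
      (y := fun x k => Y (ω k) x) fun k => lowDeg_modTest hp _ _
  · have h := prob_many_successes_le (fun ω => Y ω x = true) (prob_modTest_le (p := p) hB x hx) 1 ℓ
      (by norm_num at he ⊢; linarith)
    refine (prob_mono fun ω hω => ?_).trans h
    simp only [one_mul, Bool.decide_eq_true]
    by_contra hc
    exact hω (if_pos (by omega))
  · have h := prob_many_successes_le (fun ω => Y ω x = false)
      (prob_modTest_eq_false_le (p := p) hp hB x hx) 7 ℓ (by norm_num at he ⊢; linarith)
    refine (prob_mono fun ω hω => ?_).trans h
    have h1 : weight (fun k => Y (ω k) x) < ℓ := by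
      by_contra hc
      exact hω (if_neg hc)
    have h2 := weight_not (fun k => Y (ω k) x)
    have h3 : (fun k => decide (Y (ω k) x = false)) = fun k => !(Y (ω k) x) := by
      ext k; cases Y (ω k) x <;> rfl
    simp only [h3]
    omega

/-! ### Gap thresholds in arbitrary characteristic -/

theorem prob_dyadic {J j : ℕ} (hj : j ≤ J) :
    prob (fun a : Fin (2 ^ J) => a.val < 2 ^ (J - j)) = 1 / 2 ^ j := by
  rw [prob_fin_val_lt (Nat.pow_le_pow_right (by norm_num) (Nat.sub_le _ _))]
  push_cast
  rw [div_eq_div_iff (by positivity) (by positivity), one_mul, ← pow_add, Nat.sub_add_cancel hj]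

theorem exp_half_le_two : Real.exp (1 / 2) ≤ 2 := by
  have h : Real.exp (1 / 2) ^ 2 = Real.exp 1 := by rw [← Real.exp_nat_mul]; norm_num
  have := Real.exp_one_lt_d9
  nlinarith [Real.exp_pos (1 / 2)]

/-- Over any field, weights below `B` are separated from weights at least `32 B` in degree
`O(ℓ log n)`, with error `e^{-ℓ}`, provided `ℓ ≤ B`.

Let `S_0 ⊇ S_1 ⊇ …` be random sets, `S_j` of density `2^{-j}`. The output is the product, over the
scales `j ≤ log₂ n + 1` with `B ≤ 2^j ℓ`, of a polynomial in `|x ∧ S_j|` equal to `1` on `[0, 4ℓ)`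
and to `0` on `[4ℓ, 128ℓ]`. If `|x| < B`, then the largest of the sets used, and so all of them,
meet `x` in fewer than `4ℓ` points. If `|x| ≥ 32 B`, then at the scale with
`16ℓ ≤ 2^{-j} |x| < 32ℓ` the factor vanishes. -/
theorem exists_gap_threshold_log (F : Type*) [Field F] (n : ℕ) {ℓ B : ℕ} (hℓ : 1 ≤ ℓ)
    (hB : ℓ ≤ B) :
    ∃ (Ω : Type) (_ : Fintype Ω) (_ : Nonempty Ω) (T : Ω → (Fin n → Bool) → F),
      (∀ ω, LowDeg ((Nat.log 2 n + 2) * (128 * ℓ)) (T ω)) ∧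
      (∀ x, weight x < B → prob (fun ω => T ω x ≠ 1) ≤ Real.exp (-ℓ)) ∧
      ∀ x, 32 * B ≤ weight x → prob (fun ω => T ω x ≠ 0) ≤ Real.exp (-ℓ) := by
  have hℓR : (1 : ℝ) ≤ ℓ := by exact_mod_cast hℓ
  set J := Nat.log 2 n + 1 with hJ
  have hn : n < 2 ^ J := Nat.lt_pow_succ_log_self (by norm_num) n
  obtain ⟨φ, hφ, hφ'⟩ := exists_lowDeg_interpolation (F := F) n (128 * ℓ) 0
    (fun v => if v < 4 * ℓ then 1 else 0)
  let S : (Fin n → Fin (2 ^ J)) → ℕ → Fin n → Bool := fun ω j i =>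
    decide ((ω i).val < 2 ^ (J - j))
  refine ⟨Fin n → Fin (2 ^ J), inferInstance, inferInstance,
    fun ω x => ∏ j ∈ (Finset.range (J + 1)).filter (fun j => B ≤ 2 ^ j * ℓ), φ (mask (S ω j) x),
    fun ω => ?_, fun x hx => ?_, fun x hx => ?_⟩
  · refine (lowDeg_prod _ fun j _ => hφ.comp_mask (S ω j)).mono ?_
    rw [Finset.sum_const, smul_eq_mul]
    refine Nat.mul_le_mul_right _ ((Finset.card_filter_le _ _).trans ?_)
    rw [Finset.card_range]
  · have hex : ∃ j, B ≤ 2 ^ j * ℓ := ⟨B, by nlinarith [Nat.lt_two_pow_self (n := B)]⟩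
    classical
    set j₀ := Nat.find hex with hj₀
    have hj₀' : B ≤ 2 ^ j₀ * ℓ := Nat.find_spec hex
    by_cases hjJ : j₀ ≤ J
    · have hxR : (weight x : ℝ) ≤ 2 ^ j₀ * ℓ := by exact_mod_cast hx.le.trans hj₀'
      calc _ ≤ prob (fun ω : Fin n → Fin (2 ^ J) => 4 * ℓ ≤
            weight (fun i => decide ((ω i).val < 2 ^ (J - j₀)) && x i)) := by
            refine prob_mono fun ω hω => ?_
            by_contra hc
            refine hω (Finset.prod_eq_one fun j hj => ?_)
            have hj1 : j₀ ≤ j := Nat.find_min' hex (Finset.mem_filter.1 hj).2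
            have hle : weight (mask (S ω j) x) ≤ weight (mask (S ω j₀) x) := by
              refine Finset.card_le_card fun i => ?_
              simp only [Finset.mem_filter, Finset.mem_univ, true_and, mask, S, Bool.and_eq_true,
                decide_eq_true_eq]
              exact fun h => ⟨h.1.trans_le (Nat.pow_le_pow_right (by norm_num) (by omega)), h.2⟩
            have hlt : weight (mask (S ω j) x) < 4 * ℓ := lt_of_le_of_lt hle (not_le.1 hc)
            rw [hφ' _ (Nat.zero_le _) (by omega), if_pos hlt]
        _ ≤ _ := prob_le_card_le x (fun a : Fin (2 ^ J) => a.val < 2 ^ (J - j₀)) (z := 2)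
            (by norm_num) (4 * ℓ)
        _ ≤ Real.exp ℓ / Real.exp (2 * ℓ) := by
            rw [prob_dyadic hjJ]
            refine div_le_div₀ (Real.exp_pos _).le ?_ (Real.exp_pos _) ?_
            · refine (one_add_pow_le_exp (by positivity) _).trans (Real.exp_le_exp.2 ?_)
              rw [show (2 - 1 : ℝ) * (1 / 2 ^ j₀) * weight x = weight x / 2 ^ j₀ by
                field_simp; norm_num, div_le_iff₀ (by positivity)]
              linarith
            · have h := pow_le_pow_left₀ (Real.exp_pos _).le exp_half_le_two (4 * ℓ)
              rw [← Real.exp_nat_mul] at h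
              refine le_trans (le_of_eq ?_) h
              congr 1
              push_cast
              ring
        _ = Real.exp (-ℓ) := by
            rw [← Real.exp_sub]
            congr 1
            ring
    · rw [prob_eq_zero]
      · exact (Real.exp_pos _).le
      · intro ω hω
        refine hω (Finset.prod_eq_one fun j hj => ?_)
        have hj1 : j₀ ≤ j := Nat.find_min' hex (Finset.mem_filter.1 hj).2
        have hj2 := Finset.mem_range.1 (Finset.mem_filter.1 hj).1
        omega
  · have hxJ : weight x < 32 * ℓ * 2 ^ J := by
      have := weight_le x
      nlinarith [Nat.one_le_two_pow (n := J)]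
    have hex : ∃ j, weight x < 32 * ℓ * 2 ^ j := ⟨J, hxJ⟩
    classical
    set j := Nat.find hex with hj
    have hj1 : weight x < 32 * ℓ * 2 ^ j := Nat.find_spec hex
    have hjJ : j ≤ J := Nat.find_min' hex hxJ
    have hj0 : j ≠ 0 := by
      intro h0
      rw [h0] at hj1
      omega
    have hj2 : 16 * ℓ * 2 ^ j ≤ weight x := by
      have h := Nat.find_min hex (m := j - 1) (by omega)
      obtain ⟨i, hi⟩ := Nat.exists_eq_succ_of_ne_zero hj0
      rw [hi] at h ⊢
      simp only [Nat.succ_sub_one, not_lt] at h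
      rw [pow_succ]
      linarith
    have hjB : B ≤ 2 ^ j * ℓ := by
      have : 32 * B < 32 * (2 ^ j * ℓ) := by linarith
      omega
    have hR1 : (weight x : ℝ) ≤ 32 * ℓ * 2 ^ j := by exact_mod_cast hj1.le
    have hR2 : 16 * (ℓ : ℝ) * 2 ^ j ≤ weight x := by exact_mod_cast hj2
    have hlow : prob (fun ω : Fin n → Fin (2 ^ J) =>
        weight (fun i => decide ((ω i).val < 2 ^ (J - j)) && x i) ≤ 4 * ℓ) ≤
          Real.exp (-((ℓ : ℝ) + 1)) := by
      refine (prob_card_le_le x (fun a : Fin (2 ^ J) => a.val < 2 ^ (J - j)) (z := 1 / 2)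
        (by norm_num) (by norm_num) (4 * ℓ)).trans ?_
      rw [prob_dyadic hjJ, one_div_pow, div_div_eq_mul_div, div_one]
      have h1 : (1 + (1 / 2 - 1) * (1 / 2 ^ j) : ℝ) ^ weight x ≤ Real.exp (-(8 * ℓ)) := by
        have h2 : (1 / 2 ^ j : ℝ) ≤ 1 := by
          rw [div_le_one (by positivity)]
          exact one_le_pow₀ (by norm_num)
        refine (one_add_pow_le_exp (by linarith) _).trans (Real.exp_le_exp.2 ?_)
        rw [show (1 / 2 - 1 : ℝ) * (1 / 2 ^ j) * weight x = -(weight x / (2 * 2 ^ j)) by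
          field_simp; norm_num, neg_le_neg_iff, le_div_iff₀ (by positivity)]
        linarith
      have h3 : (2 : ℝ) ^ (4 * ℓ) ≤ Real.exp (4 * ℓ) := by
        have h4 : (2 : ℝ) ≤ Real.exp 1 := by linarith [Real.add_one_le_exp (1 : ℝ)]
        refine (pow_le_pow_left₀ (by norm_num) h4 _).trans (le_of_eq ?_)
        rw [← Real.exp_nat_mul]
        push_cast
        ring_nf
      refine (mul_le_mul h1 h3 (by positivity) (Real.exp_pos _).le).trans ?_
      rw [← Real.exp_add]
      exact Real.exp_le_exp.2 (by linarith)
    have hhigh : prob (fun ω : Fin n → Fin (2 ^ J) =>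
        128 * ℓ ≤ weight (fun i => decide ((ω i).val < 2 ^ (J - j)) && x i)) ≤
          Real.exp (-((ℓ : ℝ) + 1)) := by
      refine (prob_le_card_le x (fun a : Fin (2 ^ J) => a.val < 2 ^ (J - j)) (z := 2)
        (by norm_num) (128 * ℓ)).trans ?_
      rw [prob_dyadic hjJ]
      have h1 : (1 + (2 - 1) * (1 / 2 ^ j) : ℝ) ^ weight x ≤ Real.exp (32 * ℓ) := by
        refine (one_add_pow_le_exp (by positivity) _).trans (Real.exp_le_exp.2 ?_)
        rw [show (2 - 1 : ℝ) * (1 / 2 ^ j) * weight x = weight x / 2 ^ j by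
          field_simp; norm_num, div_le_iff₀ (by positivity)]
        linarith
      have h3 : Real.exp (64 * ℓ) ≤ (2 : ℝ) ^ (128 * ℓ) := by
        have h := pow_le_pow_left₀ (Real.exp_pos _).le exp_half_le_two (128 * ℓ)
        rw [← Real.exp_nat_mul] at h
        refine le_trans (le_of_eq ?_) h
        congr 1
        push_cast
        ring
      refine (div_le_div₀ (Real.exp_pos _).le h1 (Real.exp_pos _) h3).trans ?_
      rw [← Real.exp_sub]
      exact Real.exp_le_exp.2 (by linarith)
    refine le_trans ?_ ((add_le_add hlow hhigh).trans exp_neg_add_one_add_self_le)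
    refine (prob_mono fun ω hω => ?_).trans (prob_or_le _ _)
    by_contra hc
    rw [not_or, not_le, not_le] at hc
    refine hω (Finset.prod_eq_zero
      (Finset.mem_filter.2 ⟨Finset.mem_range.2 (by omega : j < J + 1), hjB⟩) ?_)
    have hc1 : 4 * ℓ < weight (mask (S ω j) x) := hc.1
    have hc2 : weight (mask (S ω j) x) < 128 * ℓ := hc.2
    rw [hφ' _ (Nat.zero_le _) (by omega), if_neg (by omega)]

/-- Gap thresholds of degree `O(λ_n ℓ)`, where `λ_n` is `1` in positive characteristic and
`1 + log n` in characteristic zero. -/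
theorem exists_gap_threshold (F : Type*) [Field F] (p : ℕ) [CharP F p] (n : ℕ) {ℓ B : ℕ}
    (hℓ : 1 ≤ ℓ) (hB : ℓ ≤ B) :
    ∃ (Ω : Type) (_ : Fintype Ω) (_ : Nonempty Ω) (T : Ω → (Fin n → Bool) → F) (d : ℕ),
      (d : ℝ) ≤ 256 * (p + 1) * softFactor p 1 n * ℓ ∧ (∀ ω, LowDeg d (T ω)) ∧
      (∀ x, weight x < B → prob (fun ω => T ω x ≠ 1) ≤ Real.exp (-ℓ)) ∧
      ∀ x, 2560 * B ≤ weight x → prob (fun ω => T ω x ≠ 0) ≤ Real.exp (-ℓ) := by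
  rcases CharP.char_is_prime_or_zero F p with hp | rfl
  · obtain ⟨Ω, i1, i2, T, hT, h1, h2⟩ := exists_gap_threshold_of_prime F hp n ℓ (hℓ.trans hB)
    refine ⟨Ω, i1, i2, T, _, ?_, hT, h1, h2⟩
    rw [softFactor, if_neg hp.ne_zero, mul_one]
    have h3 : 8 * ℓ * (p - 1) ≤ 256 * (p + 1) * ℓ := by
      calc 8 * ℓ * (p - 1) ≤ 256 * ℓ * (p + 1) := by gcongr <;> omega
        _ = _ := by ring
    exact_mod_cast h3
  · obtain ⟨Ω, i1, i2, T, hT, h1, h2⟩ := exists_gap_threshold_log F n hℓ hB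
    refine ⟨Ω, i1, i2, T, _, ?_, hT, h1, fun x hx => h2 x (by omega)⟩
    rw [softFactor, if_pos rfl, pow_one]
    have h3 : (Nat.log 2 n : ℝ) ≤ 2 * Real.log n := by
      rcases Nat.eq_zero_or_pos n with rfl | hn
      · simp
      · have h4 : ((2 ^ Nat.log 2 n : ℕ) : ℝ) ≤ n := by
          exact_mod_cast Nat.pow_log_le_self 2 hn.ne'
        push_cast at h4
        have h5 := Real.log_le_log (by positivity) h4
        rw [Real.log_pow] at h5
        have h6 := Real.log_two_gt_d9
        nlinarith [Nat.cast_nonneg (α := ℝ) (Nat.log 2 n)]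
    push_cast
    have h7 : (0 : ℝ) ≤ ℓ := Nat.cast_nonneg _
    nlinarith

/-! ### Symmetric and bounded functions -/

section Construction

variable {F : Type*} [Field F] {n : ℕ}

theorem toField_xor (a b : Bool) :
    toField F (xor a b) = toField F a + toField F b - 2 * (toField F a * toField F b) := by
  cases a <;> cases b <;> simp [toField]
  norm_num

theorem lowDeg_symmetric {f : (Fin n → Bool) → Bool} (hf : IsSymmetric f) :
    LowDeg n (fun x => toField F (f x)) := by
  convert lowDeg_weight (n := n) (fun i => toField F (spec f i)) using 3 with x
  exact hf.eq_spec x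

theorem lowDeg_xor {f g : (Fin n → Bool) → Bool} {d e : ℕ}
    (hf : LowDeg d (fun x => toField F (f x)))
    (hg : LowDeg e (fun x => toField F (g x))) :
    LowDeg (d + e) (fun x => toField F (xor (f x) (g x))) := by
  simp only [toField_xor]
  exact ((hf.mono (Nat.le_add_right d e)).add (hg.mono (Nat.le_add_left e d))).sub
    ((hf.mul hg).const_mul 2)

/-- Every symmetric function has random approximations of degree `O(√(nℓ) + ℓ)` with error
`e^{-ℓ}`. -/
theorem exists_random_symmetric (F : Type*) [Field F] {f : (Fin n → Bool) → Bool}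
    (hf : IsSymmetric f) {ℓ : ℕ} (hℓ : 10 ≤ ℓ) :
    ∃ (Ω : Type) (_ : Fintype Ω) (_ : Nonempty Ω) (R : Ω → (Fin n → Bool) → F) (d : ℕ),
      (d : ℝ) ≤ 256 * (√((n + 1) * ℓ) + ℓ) ∧ (∀ ω, LowDeg d (R ω)) ∧
      ∀ x, prob (fun ω => R ω x ≠ toField F (f x)) ≤ Real.exp (-ℓ) := by
  obtain ⟨Ω, i1, i2, R, d, hd, hR, hR'⟩ := exists_random_weight_indicators F n (n + 1) ℓ hℓ
  refine ⟨Ω, i1, i2, fun ω x => ∑ w ∈ Finset.range (n + 1), toField F (spec f w) * R ω w x, d,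
    by exact_mod_cast hd, fun ω => lowDeg_sum _ fun w _ => (hR ω w).const_mul _, fun x => ?_⟩
  have hx : weight x < n + 1 := Nat.lt_succ_of_le (weight_le x)
  refine (prob_mono fun ω hω => ?_).trans (hR' x hx)
  by_contra hgood
  push Not at hgood
  apply hω
  simp only [hgood]
  rw [hf.eq_spec x]
  simp [hx]

/-- Random functions computing the indicators of the weights `w < B` on the whole cube: multiply
the indicators that are reliable below weight `M = O(B + ℓ)` by a gap threshold which vanishes
from `M` on. -/
theorem exists_random_small_weight_indicators (F : Type*) [Field F] (p : ℕ) [CharP F p]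
    (n B : ℕ) {ℓ : ℕ} (hℓ : 10 ≤ ℓ) :
    ∃ (Ω : Type) (_ : Fintype Ω) (_ : Nonempty Ω) (U : Ω → ℕ → (Fin n → Bool) → F) (d : ℕ),
      (d : ℝ) ≤ 13312 * (√(B * ℓ) + ℓ) + 256 * (p + 1) * softFactor p 1 n * ℓ ∧
      (∀ ω w, LowDeg d (U ω w)) ∧
      ∀ x, prob (fun ω => ∃ w < B, U ω w x ≠ if weight x = w then 1 else 0) ≤
        2 * Real.exp (-ℓ) := by
  obtain ⟨Ω₁, i1, i2, R, d₁, hd₁, hR, hR'⟩ :=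
    exists_random_weight_indicators F n (2560 * max B ℓ) ℓ hℓ
  obtain ⟨Ω₂, i3, i4, T, d₂, hd₂, hT, hT1, hT0⟩ :=
    exists_gap_threshold F p n (ℓ := ℓ) (B := max B ℓ) (by omega) (le_max_right _ _)
  refine ⟨Ω₁ × Ω₂, inferInstance, inferInstance, fun ω w x => R ω.1 w x * T ω.2 x, d₁ + d₂, ?_,
    fun ω w => (hR _ _).mul (hT _), fun x => ?_⟩
  · have h1 : √(((2560 * max B ℓ : ℕ) : ℝ) * ℓ) ≤ 51 * (√(B * ℓ) + ℓ) := by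
      refine Real.sqrt_le_iff.2 ⟨by positivity, ?_⟩
      have h2 : √((B : ℝ) * ℓ) ^ 2 = B * ℓ := Real.sq_sqrt (by positivity)
      have h3 := Real.sqrt_nonneg ((B : ℝ) * ℓ)
      have h4 : (0 : ℝ) ≤ ℓ := Nat.cast_nonneg _
      have h5 : ((max B ℓ : ℕ) : ℝ) ≤ B + ℓ := by
        exact_mod_cast max_le (Nat.le_add_right B ℓ) (Nat.le_add_left ℓ B)
      have h6 : ((max B ℓ : ℕ) : ℝ) * ℓ ≤ (√((B : ℝ) * ℓ) + ℓ) ^ 2 := by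
        nlinarith [mul_le_mul_of_nonneg_right h5 h4, mul_nonneg h3 h4]
      have h7 : (0 : ℝ) ≤ (√((B : ℝ) * ℓ) + ℓ) ^ 2 := sq_nonneg _
      push_cast at h6 ⊢
      nlinarith
    push_cast at hd₁ hd₂ h1 ⊢
    have := Real.sqrt_nonneg ((B : ℝ) * ℓ)
    linarith
  · have he := Real.exp_pos (-(ℓ : ℝ))
    rcases lt_or_ge (weight x) (2560 * max B ℓ) with hM | hM
    · have h1 := hR' x hM
      rw [← prob_fst (Ω' := Ω₂)] at h1
      rcases lt_or_ge (weight x) (max B ℓ) with hB | hB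
      · have h2 := hT1 x hB
        rw [← prob_snd (Ω := Ω₁)] at h2
        refine le_trans ?_ ((add_le_add h1 h2).trans (by linarith))
        refine (prob_mono fun ω hω => ?_).trans (prob_or_le _ _)
        by_contra hgood
        push Not at hgood
        obtain ⟨w, -, hw⟩ := hω
        exact hw (by simp only [hgood.1, hgood.2, mul_one])
      · refine le_trans (prob_mono fun ω hω => ?_) (h1.trans (by linarith))
        by_contra hgood
        push Not at hgood
        obtain ⟨w, hwB, hw⟩ := hω
        have hne : weight x ≠ w := by
          have := le_max_left B ℓ
          omega
        exact hw (by simp only [hgood, if_neg hne, zero_mul])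
    · have h2 := hT0 x hM
      rw [← prob_snd (Ω := Ω₁)] at h2
      refine le_trans (prob_mono fun ω hω => ?_) (h2.trans (by linarith))
      by_contra hgood
      obtain ⟨w, hwB, hw⟩ := hω
      have hne : weight x ≠ w := by
        have := le_max_left B ℓ
        omega
      exact hw (by simp only [hgood, if_neg hne, mul_zero])

theorem one_le_softFactor (p k n : ℕ) : 1 ≤ softFactor p k n := by
  rw [softFactor]
  split_ifs
  · exact one_le_pow₀ (by linarith [Real.log_natCast_nonneg n])
  · exact le_rfl

/-- Random approximations of a bounded symmetric function `h`. If `2 B ≤ n`, then `h` is a constant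
plus corrections at the weights `w < B`, which are found from `x`, and at the weights
`n - w` with `w < B`, which are found from the negation of `x`. If `2 B > n`, the bound for all
symmetric functions suffices. -/
theorem exists_random_bounded (F : Type*) [Field F] (p : ℕ) [CharP F p]
    {h : (Fin n → Bool) → Bool} (hh : IsSymmetric h) {B : ℕ} (hB : IsBounded h B) {ℓ : ℕ}
    (hℓ : 10 ≤ ℓ) :
    ∃ (Ω : Type) (_ : Fintype Ω) (_ : Nonempty Ω) (R : Ω → (Fin n → Bool) → F) (d : ℕ),
      (d : ℝ) ≤ 14000 * (p + 1) * softFactor p 1 n * (√(B * ℓ) + ℓ) ∧ (∀ ω, LowDeg d (R ω)) ∧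
      ∀ x, prob (fun ω => R ω x ≠ toField F (h x)) ≤ 4 * Real.exp (-ℓ) := by
  have he := Real.exp_pos (-(ℓ : ℝ))
  have hs := one_le_softFactor p 1 n
  have hp : (0 : ℝ) ≤ p := Nat.cast_nonneg _
  have hK : (1 : ℝ) ≤ (p + 1) * softFactor p 1 n := by nlinarith
  have hr := Real.sqrt_nonneg ((B : ℝ) * ℓ)
  have hℓ0 : (0 : ℝ) ≤ ℓ := Nat.cast_nonneg _
  rcases lt_or_ge n (2 * B) with hn | hn
  · obtain ⟨Ω, i1, i2, R, d, hd, hR, hR'⟩ := exists_random_symmetric F hh hℓ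
    refine ⟨Ω, i1, i2, R, d, hd.trans ?_, hR, fun x => (hR' x).trans (by linarith)⟩
    have h1 : √(((n : ℝ) + 1) * ℓ) ≤ 2 * √(B * ℓ) := by
      have h2 : (n : ℝ) + 1 ≤ 2 * B := by exact_mod_cast hn
      refine Real.sqrt_le_iff.2 ⟨by positivity, ?_⟩
      rw [mul_pow, Real.sq_sqrt (by positivity)]
      nlinarith [mul_nonneg (Nat.cast_nonneg (α := ℝ) B) hℓ0]
    have h3 := mul_le_mul_of_nonneg_right hK (add_nonneg hr hℓ0)
    linarith
  · obtain ⟨Ω, i1, i2, U, d, hd, hU, hU'⟩ := exists_random_small_weight_indicators F p n B hℓ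
    let s : ℕ → F := fun i => toField F (spec h i)
    refine ⟨Ω, i1, i2, fun ω x => s B + ∑ w ∈ Finset.range B, (s w - s B) * U ω w x
      + ∑ w ∈ Finset.range B, (s (n - w) - s B) * U ω w (fun i => !(x i)), d, hd.trans ?_,
      fun ω => ?_, fun x => ?_⟩
    · have h3 := mul_le_mul_of_nonneg_right hK (add_nonneg hr hℓ0)
      have h4 := mul_nonneg (zero_le_one.trans hK) hr
      linarith
    · exact ((lowDeg_const _).add (lowDeg_sum _ fun w _ => (hU ω w).const_mul _)).add
        (lowDeg_sum _ fun w _ => (hU ω w).comp_not.const_mul _)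
    · have hnot := weight_not x
      refine le_trans ?_ ((add_le_add (hU' x) (hU' (fun i => !(x i)))).trans (by linarith))
      refine (prob_mono fun ω hω => ?_).trans (prob_or_le _ _)
      by_contra hgood
      push Not at hgood
      apply hω
      have h1 : ∑ w ∈ Finset.range B, (s w - s B) * U ω w x
          = if weight x < B then s (weight x) - s B else 0 := by
        rw [Finset.sum_congr rfl fun w hw => by rw [hgood.1 w (Finset.mem_range.1 hw)]]
        simp
      have h2 : ∑ w ∈ Finset.range B, (s (n - w) - s B) * U ω w (fun i => !(x i))
          = if weight (fun i => !(x i)) < B then s (weight x) - s B else 0 := by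
        rw [Finset.sum_congr rfl fun w hw => by rw [hgood.2 w (Finset.mem_range.1 hw)]]
        simp only [mul_ite, mul_one, mul_zero, Finset.sum_ite_eq, Finset.mem_range]
        rw [show n - weight (fun i => !(x i)) = weight x by omega]
      simp only [h1, h2]
      rw [hh.eq_spec x]
      change _ = s (weight x)
      by_cases h3 : weight x < B
      · rw [if_pos h3, if_neg (by omega)]
        ring
      · rw [if_neg h3]
        split_ifs with h4
        · ring
        · have : spec h B = spec h (weight x) := hB _ _ le_rfl (by omega) (by omega) (by omega)
          simp [s, this]

end Construction

/-! ### Bounds on the probabilistic degree -/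

section Pdeg

variable {F : Type*} [Field F] {n : ℕ}

theorem pdeg_le_of_random {Ω : Type} [Fintype Ω] [Nonempty Ω] {f : (Fin n → Bool) → Bool} {d : ℕ}
    {ε : ℝ} (R : Ω → (Fin n → Bool) → F) (hR : ∀ ω, LowDeg d (R ω))
    (hε : ∀ x, prob (fun ω => R ω x ≠ toField F (f x)) ≤ ε) : pdeg F ε f ≤ d := by
  classical
  choose Q hQ hQ' using hR
  refine Nat.sInf_le ⟨(PMF.uniformOfFintype Ω).map Q, ?_, ?_, fun a => ?_⟩
  · rw [PMF.support_map]
    exact (Set.toFinite _).image _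
  · intro P hP
    rw [PMF.support_map] at hP
    obtain ⟨ω, -, rfl⟩ := hP
    exact hQ ω
  · rw [PMF.toOuterMeasure_map_apply, PMF.toOuterMeasure_uniformOfFintype_apply]
    refine le_trans (le_of_eq ?_) (ENNReal.ofReal_le_ofReal (hε a))
    rw [prob_eq_card_div, ENNReal.ofReal_div_of_pos (by exact_mod_cast Fintype.card_pos),
      ENNReal.ofReal_natCast, ENNReal.ofReal_natCast, Fintype.card_subtype]
    congr 3
    ext ω
    simp [hQ']

theorem pdeg_le_of_lowDeg {f : (Fin n → Bool) → Bool} {d : ℕ} {ε : ℝ} (hε : 0 < ε)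
    (hf : LowDeg d (fun x => toField F (f x))) : pdeg F ε f ≤ d := by
  refine pdeg_le_of_random (Ω := Unit) (fun _ x => toField F (f x)) (fun _ => hf) fun x => ?_
  rw [prob_eq_zero (by simp)]
  exact hε.le

/-- Error `1/2` is achieved by a random constant. -/
theorem pdeg_eq_zero_of_half_le (F : Type*) [Field F] (f : (Fin n → Bool) → Bool) {ε : ℝ}
    (hε : 1 / 2 ≤ ε) : pdeg F ε f = 0 := by
  refine Nat.le_zero.1 (pdeg_le_of_random (Ω := Bool) (fun b _ => toField F b)
    (fun b => lowDeg_const _) fun x => le_trans ?_ hε)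
  refine prob_le_half_of_equiv Equiv.boolNot fun b hb => ?_
  cases b <;> cases h : f x <;> simp_all [Equiv.boolNot]

/-- For `ε < 1/2` there is an integer `ℓ ≥ 10` of the order of `log (1/ε)` with `4 e^{-ℓ} ≤ ε`. -/
theorem exists_exponent {ε : ℝ} (h0 : 0 < ε) (h1 : ε < 1 / 2) :
    ∃ ℓ : ℕ, 10 ≤ ℓ ∧ (ℓ : ℝ) ≤ 17 * logInv ε ∧ 4 * Real.exp (-ℓ) ≤ ε := by
  have hL : Real.log 2 ≤ Real.log (1 / ε) :=
    Real.log_le_log (by norm_num) (by rw [le_div_iff₀ h0]; linarith)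
  have h2 := Real.log_two_gt_d9
  have hLL : logInv ε = Real.log (1 / ε) := max_eq_left (by linarith)
  rw [hLL]
  refine ⟨⌈Real.log (1 / ε)⌉₊ + 10, by omega, ?_, ?_⟩
  · have := Nat.ceil_lt_add_one (a := Real.log (1 / ε)) (by linarith)
    push_cast
    linarith
  · have h3 := Nat.le_ceil (Real.log (1 / ε))
    have h4 : Real.exp (-((⌈Real.log (1 / ε)⌉₊ + 10 : ℕ) : ℝ))
        ≤ Real.exp (-(Real.log (1 / ε)) + -10) := by
      refine Real.exp_le_exp.2 ?_
      push_cast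
      linarith
    have h5 : Real.exp (-(Real.log (1 / ε))) = ε := by
      rw [Real.exp_neg, Real.exp_log (by positivity)]
      simp
    rw [Real.exp_add, h5, Real.exp_neg 10] at h4
    have h6 : (4 : ℝ) * (Real.exp 10)⁻¹ ≤ 1 := by
      rw [← div_eq_mul_inv, div_le_one (Real.exp_pos _)]
      linarith [Real.add_one_le_exp (10 : ℝ)]
    nlinarith

theorem sqrt_mul_le_of_le {b ℓ L : ℝ} (hb : 0 ≤ b) (hL : 0 ≤ L) (hℓ : ℓ ≤ 17 * L) :
    √(b * ℓ) ≤ 5 * √(b * L) := by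
  rw [show (5 : ℝ) = √25 by rw [show (25 : ℝ) = 5 ^ 2 by norm_num, Real.sqrt_sq (by norm_num)],
    ← Real.sqrt_mul (by norm_num)]
  refine Real.sqrt_le_sqrt ?_
  nlinarith [mul_le_mul_of_nonneg_left hℓ hb, mul_nonneg hb hL]

/-- The probabilistic degree of a symmetric function is `O(√(n log (1/ε)))`, over any field. -/
theorem pdeg_symmetric_le (F : Type*) [Field F] {f : (Fin n → Bool) → Bool} (hf : IsSymmetric f)
    {ε : ℝ} (hε : 0 < ε) : (pdeg F ε f : ℝ) ≤ 5000 * √(n * logInv ε) := by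
  have hL : 0 ≤ logInv ε := le_max_right _ _
  rcases le_or_gt (1 / 2) ε with h | h
  · rw [pdeg_eq_zero_of_half_le F f h, Nat.cast_zero]
    positivity
  · obtain ⟨ℓ, hℓ, hℓ', hℓε⟩ := exists_exponent hε h
    have hsq := sqrt_mul_le_of_le (b := (n : ℝ)) (Nat.cast_nonneg _) hL hℓ'
    have hr := Real.sqrt_nonneg ((n : ℝ) * ℓ)
    have hℓ0 : (10 : ℝ) ≤ ℓ := by exact_mod_cast hℓ
    suffices (pdeg F ε f : ℝ) ≤ 768 * √(n * ℓ) by linarith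
    rcases lt_or_ge n ℓ with hn | hn
    · have h1 : (pdeg F ε f : ℝ) ≤ n := by
        exact_mod_cast pdeg_le_of_lowDeg hε (lowDeg_symmetric hf)
      have h2 : (n : ℝ) ≤ √(n * ℓ) := by
        have : (n : ℝ) ≤ ℓ := by exact_mod_cast hn.le
        exact Real.le_sqrt_of_sq_le (by nlinarith [Nat.cast_nonneg (α := ℝ) n])
      linarith
    · obtain ⟨Ω, _, _, R, d, hd, hR, hR'⟩ := exists_random_symmetric F hf hℓ
      have h1 : (pdeg F ε f : ℝ) ≤ d := by
        exact_mod_cast pdeg_le_of_random R hR fun x => (hR' x).trans (by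
          linarith [Real.exp_pos (-(ℓ : ℝ))])
      have hnR : (ℓ : ℝ) ≤ n := by exact_mod_cast hn
      have h2 : (ℓ : ℝ) ≤ √(n * ℓ) := Real.le_sqrt_of_sq_le (by nlinarith)
      have h3 : √(((n : ℝ) + 1) * ℓ) ≤ 2 * √(n * ℓ) := by
        refine Real.sqrt_le_iff.2 ⟨by positivity, ?_⟩
        rw [mul_pow, Real.sq_sqrt (by positivity)]
        nlinarith
      linarith

/-- The sum modulo two of a function of exact degree `e` and a bounded function. -/
theorem pdeg_xor_le (p : ℕ) [CharP F p] {g h : (Fin n → Bool) → Bool} {e B : ℕ}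
    (hg : LowDeg e (fun x => toField F (g x))) (hh : IsSymmetric h) (hB : IsBounded h B)
    {ε : ℝ} (hε : 0 < ε) :
    (pdeg F ε (fun x => xor (g x) (h x)) : ℝ) ≤
      e + 238000 * (p + 1) * softFactor p 1 n * (√(B * logInv ε) + logInv ε) := by
  have hs := one_le_softFactor p 1 n
  have hL : 0 ≤ logInv ε := le_max_right _ _
  have hK : (0 : ℝ) ≤ (p + 1) * softFactor p 1 n := by positivity
  rcases le_or_gt (1 / 2) ε with hlarge | hsmall
  · rw [pdeg_eq_zero_of_half_le F _ hlarge]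
    push_cast
    positivity
  · obtain ⟨ℓ, hℓ, hℓ', hℓε⟩ := exists_exponent hε hsmall
    obtain ⟨Ω, _, _, R, d, hd, hR, hR'⟩ := exists_random_bounded F p hh hB hℓ
    have h1 : pdeg F ε (fun x => xor (g x) (h x)) ≤ e + d := by
      refine pdeg_le_of_random
        (fun ω x => toField F (g x) + R ω x - 2 * (toField F (g x) * R ω x)) (fun ω => ?_)
        fun x => le_trans (prob_mono fun ω hω => ?_) ((hR' x).trans hℓε)
      · exact ((hg.mono (Nat.le_add_right e d)).add ((hR ω).mono (Nat.le_add_left d e))).sub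
          ((hg.mul (hR ω)).const_mul 2)
      · intro hc
        exact hω (by rw [toField_xor, hc])
    have h2 : (pdeg F ε (fun x => xor (g x) (h x)) : ℝ) ≤ e + d := by exact_mod_cast h1
    have h3 : √((B : ℝ) * ℓ) + ℓ ≤ 17 * (√(B * logInv ε) + logInv ε) := by
      have := sqrt_mul_le_of_le (b := (B : ℝ)) (Nat.cast_nonneg _) hL hℓ'
      have := Real.sqrt_nonneg ((B : ℝ) * logInv ε)
      linarith
    have h4 := mul_le_mul_of_nonneg_left h3 hK
    linarith

/-- A symmetric function of period one is constant. -/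
theorem lowDeg_of_per_eq_one (F : Type*) [Field F] {g : (Fin n → Bool) → Bool} (hg : IsSymmetric g)
    (h : per g = 1) : LowDeg 0 (fun x => toField F (g x)) := by
  have hper := (isPeriod_per g).2
  rw [h] at hper
  have hc : ∀ i, i ≤ n → spec g i = spec g 0 := by
    intro i
    induction i with
    | zero => simp
    | succ i ih => exact fun hi => (hper i hi).symm.trans (ih (by omega))
  convert lowDeg_const (n := n) (d := 0) (toField F (spec g 0)) using 3 with x
  rw [hg.eq_spec x, hc _ (weight_le x)]

theorem lowDeg_of_bdd_eq_zero (F : Type*) [Field F] {h : (Fin n → Bool) → Bool}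
    (hh : IsSymmetric h) (h0 : bdd h = 0) : LowDeg 0 (fun x => toField F (h x)) := by
  have hB := isBounded_bdd h
  rw [h0] at hB
  convert lowDeg_const (n := n) (d := 0) (toField F (spec h 0)) using 3 with x
  rw [hh.eq_spec x, hB _ 0 (Nat.zero_le _) (by simpa using weight_le x) le_rfl (by simp)]

theorem lowDeg_of_isPowerOf_per (F : Type*) [Field F] {p : ℕ} [CharP F p]
    {g : (Fin n → Bool) → Bool} (hg : IsSymmetric g) (h : IsPowerOf p (per g)) :
    LowDeg (per g) (fun x => toField F (g x)) := by
  have hper := isPeriod_per g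
  obtain ⟨t, ht, hpt⟩ := h
  rcases CharP.char_is_prime_or_zero F p with hp | rfl
  · rw [hpt] at hper ⊢
    have := lowDeg_of_periodic (F := F) (n := n) hp t (fun i => toField F (spec g i))
      fun i hi => by rw [hper.2 i hi]
    refine LowDeg.mono ?_ (Nat.sub_le _ 1)
    convert this using 3 with x
    exact hg.eq_spec x
  · rw [zero_pow (by omega)] at hpt
    exact absurd hper.1 (by omega)

end Pdeg

end SymPdeg

open SymPdeg
theorem theorem1p2 (p : ℕ) :
    ∃ (C : ℝ) (k : ℕ), 0 < C ∧
      ∀ (F : Type*) [Field F] [CharP F p] (n : ℕ) (f g h : (Fin n → Bool) → Bool),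
        IsSymmetric f → IsStandardDecomposition f g h → ∀ ε : ℝ, 0 < ε →
          -- the periodic part
          ((per g = 1 → pdeg F ε g = 0) ∧
            (IsPowerOf p (per g) → pdeg F ε g ≤ per g)) ∧
          -- the bounded part
          ((bdd h = 0 → pdeg F ε h = 0) ∧
            (1 ≤ bdd h → (pdeg F ε h : ℝ) ≤
              C * softFactor p k n * (√(bdd h * logInv ε) + logInv ε))) ∧
          -- the function itself
          ((1 < per g ∧ ¬ IsPowerOf p (per g) →
              (pdeg F ε f : ℝ) ≤ C * √(n * logInv ε)) ∧
            (IsPowerOf p (per g) ∧ bdd h = 0 →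
              (pdeg F ε f : ℝ) ≤ C * min (√(n * logInv ε)) (per g)) ∧
            (¬ (1 < per g ∧ ¬ IsPowerOf p (per g)) ∧ ¬ (IsPowerOf p (per g) ∧ bdd h = 0) →
              (pdeg F ε f : ℝ) ≤ C * softFactor p k n *
                min (√(n * logInv ε)) (per g + √(bdd h * logInv ε) + logInv ε))) := by
  refine ⟨238000 * (p + 1), 1, by positivity, ?_⟩
  intro F _ _ n f g h hf hdec ε hε
  have hg := hdec.symmetric
  have hh : IsSymmetric h := fun a b hab => by
    rw [hdec.bounded_part, hdec.bounded_part, hf a b hab, hg a b hab]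
  have hfgh : f = fun x => xor (g x) (h x) := by
    ext x
    rw [hdec.bounded_part]
    cases f x <;> cases g x <;> rfl
  have hs := one_le_softFactor p 1 n
  have hp : (0 : ℝ) ≤ p := Nat.cast_nonneg _
  have hC : (5000 : ℝ) ≤ 238000 * (p + 1) := by linarith
  have hCs : (5000 : ℝ) ≤ 238000 * (p + 1) * softFactor p 1 n := by nlinarith
  have hL : 0 ≤ logInv ε := le_max_right _ _
  have hr := Real.sqrt_nonneg (n * logInv ε)
  have hsym := pdeg_symmetric_le F hf hε
  refine ⟨⟨fun h1 => ?_, fun hpow => ?_⟩, ⟨fun h0 => ?_, fun _ => ?_⟩, fun _ => ?_,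
    fun ⟨hpow, h0⟩ => ?_, fun ⟨h1, _⟩ => ?_⟩
  · exact Nat.le_zero.1 (pdeg_le_of_lowDeg hε (lowDeg_of_per_eq_one F hg h1))
  · exact pdeg_le_of_lowDeg hε (lowDeg_of_isPowerOf_per F hg hpow)
  · exact Nat.le_zero.1 (pdeg_le_of_lowDeg hε (lowDeg_of_bdd_eq_zero F hh h0))
  · have := pdeg_xor_le (F := F) p (g := fun _ => false) (e := 0) (lowDeg_const _) hh
      (isBounded_bdd h) hε
    simpa using this
  · exact hsym.trans (mul_le_mul_of_nonneg_right hC hr)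
  · rw [mul_min_of_nonneg _ _ (by positivity)]
    refine le_min (hsym.trans (mul_le_mul_of_nonneg_right hC hr)) ?_
    have h2 : (pdeg F ε f : ℝ) ≤ per g := by
      rw [hfgh]
      exact_mod_cast pdeg_le_of_lowDeg hε
        (lowDeg_xor (lowDeg_of_isPowerOf_per F hg hpow) (lowDeg_of_bdd_eq_zero F hh h0))
    exact h2.trans (le_mul_of_one_le_left (Nat.cast_nonneg _) (by linarith))
  · rw [mul_min_of_nonneg _ _ (by positivity)]
    refine le_min (hsym.trans (mul_le_mul_of_nonneg_right hCs hr)) ?_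
    have hdeg : LowDeg (per g) (fun x => toField F (g x)) := by
      rcases Nat.lt_or_ge 1 (per g) with hlt | hle
      · exact lowDeg_of_isPowerOf_per F hg (not_not.1 fun hpow => h1 ⟨hlt, hpow⟩)
      · have hpos := (isPeriod_per g).1
        exact (lowDeg_of_per_eq_one F hg (by omega)).mono (Nat.zero_le _)
    have h2 := pdeg_xor_le (F := F) p hdeg hh (isBounded_bdd h) hε
    rw [← hfgh] at h2
    have h3 : (per g : ℝ) ≤ 238000 * (p + 1) * softFactor p 1 n * per g :=
      le_mul_of_one_le_left (Nat.cast_nonneg _) (by linarith)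
    linarith
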